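/- Let $X$ be a real separable Hilbert space and let $A$ be a skew-adjoint operator on $X$, with domain $D(A)$, such that $A^*A=-A^2$ has compact resolvent. For $\tau\ge 0$ let $X^\tau=D((A^*A)^{\tau/2})$, with the Hilbert norm $\|x\|_{X^\tau}=\|(1+A^*A)^{\tau/2}x\|_X$ (so $X^0=X$ and $X^1=D(A)$ with the graph norm). For a real Hilbert space $Y$ let $Y_{\mathbb C}=\{y_1+iy_2 : y_1,y_2\in Y\}$ be its complexification, with $\|y_1+iy_2\|^2=\|y_1\|^2+\|y_2\|^2$. Let $\sigma\ge 0$, $\varepsilon>0$, $R_0>0$ and $T^*>T>0$. Assume the following. 1. (Observability.) $\mathbf C\in\mathcal L(X^\sigma)$, $\mathbf C$ restricts to an element of $\mathcal L(X^{\sigma+\varepsilon})$, and for $\tau=\sigma$ and $\tau=\sigma+\varepsilon$ there is a constant $K_\tau>0$ such that $$\|W_0\|_{X^{\tau}}^2\le K_\tau^2\int_0^T\|\mathbf C e^{tA}W_0\|_{X^{\tau}}^2\,dt\qquad\text{for all } W_0\in X^{\tau}.$$ 2. (Commutator.) There is $s>0$ such that $[(A^*A)^s,\mathbf C]\in\mathcal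 L(X^{\sigma+2s},X^{\sigma+\varepsilon})$. 3. (Nonlinearity.) $F$ is Lipschitz and bounded from the closed ball $\{u\in X^\sigma:\|u\|_{X^\sigma}\le 4R_0\}$ to $X^{\sigma+\varepsilon}$, and for some $\delta>0$ it extends to the cylinder $\mathbb B=\{u\in X^\sigma_{\mathbb C}:\|\operatorname{Re}u\|_{X^\sigma}\le 4R_0,\ \|\operatorname{Im}u\|_{X^\sigma}\le 2\delta\}$ as a map with values in $X^{\sigma+\varepsilon}_{\mathbb C}$ that is holomorphic in the interior of $\mathbb B$ and bounded and Lipschitz on $\mathbb B$ (from the norm of $X^\sigma_{\mathbb C}$ to that of $X^{\sigma+\varepsilon}_{\mathbb C}$). 4. (Sources.) $H_1\in C^0([0,T^*],X^\sigma)$ with $\|H_1(t)\|_{X^\sigma}\le R_0$ for all $t\in[0,T^*]$, and $H_2\in C^0([0,T^*],X^{\sigma+\varepsilon})$. For some $\mu>0$, $H_1$ and $H_2$ admit extensions in $C^0([0,T^*]+i[-\mu,\mu],X^\sigma_{\mathbb C})$ and $C^0([0,T^*]+i[-\mu,\mu],X^{\sigma+\varepsilon}_{\mathbb C})$ respectively,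 both holomorphic in $(0,T^*)+i(-\mu,\mu)$, and $\|\operatorname{Re}H_1(z)\|_{X^\sigma}\le R_0$ for all $z\in[0,T^*]+i[-\mu,\mu]$. Let $U\in C^0([0,T^*],X^\sigma)$ be a mild solution of $$\partial_tU=AU+F(U+H_1)+H_2\quad\text{on }[0,T^*],\qquad \mathbf C U(t)=0\quad\text{for all }t\in[0,T^*],$$ that is, $U(t)=e^{tA}U(0)+\int_0^te^{(t-r)A}\big(F(U(r)+H_1(r))+H_2(r)\big)\,dr$ for all $t\in[0,T^*]$, such that $\|U(t)+H_1(t)\|_{X^\sigma}<4R_0$ for all $t\in[0,T^*]$ (for instance, such that $\|U(t)\|_{X^\sigma}\le R_0$ for all $t\in[0,T^*]$). Then $t\mapsto U(t)\in X^\sigma$ is real analytic on $(0,T^*)$. -/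

import Mathlib

open scoped NNReal ENNReal

noncomputable section

/-! ### Unbounded operators on a real Hilbert space -/

section Operators

variable {X : Type*} [NormedAddCommGroup X] [InnerProductSpace ℝ X] [CompleteSpace X]

/-- The operator `A* A` on its natural domain `{x ∈ D(A) | A x ∈ D(A*)}`. -/
def LinearPMap.adjointMulSelf (A : X →ₗ.[ℝ] X) : X →ₗ.[ℝ] X where
  domain :=
    { carrier := {x | ∃ h : x ∈ A.domain, A ⟨x, h⟩ ∈ A.adjoint.domain}
      add_mem' := by
        rintro x y ⟨hx, hx'⟩ ⟨hy, hy'⟩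
        refine ⟨A.domain.add_mem hx hy, ?_⟩
        have : A ⟨x + y, A.domain.add_mem hx hy⟩ = A ⟨x, hx⟩ + A ⟨y, hy⟩ :=
          A.map_add ⟨x, hx⟩ ⟨y, hy⟩
        rw [this]
        exact A.adjoint.domain.add_mem hx' hy'
      zero_mem' := by
        refine ⟨A.domain.zero_mem, ?_⟩
        have : A ⟨0, A.domain.zero_mem⟩ = 0 := A.map_zero
        rw [this]
        exact A.adjoint.domain.zero_mem
      smul_mem' := by
        rintro c x ⟨hx, hx'⟩
        refine ⟨A.domain.smul_mem c hx, ?_⟩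
        have : A ⟨c • x, A.domain.smul_mem c hx⟩ = c • A ⟨x, hx⟩ := A.map_smul c ⟨x, hx⟩
        rw [this]
        exact A.adjoint.domain.smul_mem c hx' }
  toFun :=
    { toFun := fun x => A.adjoint ⟨A ⟨x.1, x.2.1⟩, x.2.2⟩
      map_add' := by
        intro x y
        rw [← A.adjoint.map_add]
        congr 1
        exact Subtype.ext (A.map_add ⟨x.1, x.2.1⟩ ⟨y.1, y.2.1⟩)
      map_smul' := by
        intro c x
        rw [RingHom.id_apply, ← A.adjoint.map_smul]
        congr 1
        exact Subtype.ext (A.map_smul c ⟨x.1, x.2.1⟩) }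

/-- `B` has compact resolvent: for some real `z`, the operator `z - B` is a bijection from `D(B)`
onto the whole space, with a compact inverse `R = (z - B)⁻¹`. -/
def LinearPMap.HasCompactResolvent (B : X →ₗ.[ℝ] X) : Prop :=
  ∃ (z : ℝ) (R : X →L[ℝ] X), IsCompactOperator R ∧
    (∀ x : X, ∃ h : R x ∈ B.domain, z • R x - B ⟨R x, h⟩ = x) ∧
    ∀ x : B.domain, R (z • (x : X) - B x) = x

variable (X) in
/-- A (densely defined) skew-adjoint operator `A` on the real Hilbert space `X` such that `A* A`
has compact resolvent. -/
structure SkewAdjointOp where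
  /-- the underlying unbounded operator -/
  op : X →ₗ.[ℝ] X
  dense_domain : Dense (op.domain : Set X)
  skew : op.adjoint = -op
  compact_resolvent : op.adjointMulSelf.HasCompactResolvent

namespace SkewAdjointOp

variable (A : SkewAdjointOp X)

/-- For `ω ≥ 0`, the eigenspace `{x ∈ D(A* A) | A* A x = ω² x}`, that is the eigenspace of
`(A* A)^{1/2}` for the eigenvalue `ω`. -/
def eig (ω : ℝ≥0) : Submodule ℝ X where
  carrier := {x | ∃ h : x ∈ A.op.adjointMulSelf.domain,
    A.op.adjointMulSelf ⟨x, h⟩ = ((ω : ℝ) ^ 2) • x}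
  add_mem' := by
    rintro x y ⟨hx, hx'⟩ ⟨hy, hy'⟩
    refine ⟨Submodule.add_mem _ hx hy, ?_⟩
    have := A.op.adjointMulSelf.map_add ⟨x, hx⟩ ⟨y, hy⟩
    rw [hx', hy', ← smul_add] at this
    exact this
  zero_mem' := ⟨Submodule.zero_mem _, by
    rw [smul_zero]
    exact A.op.adjointMulSelf.map_zero⟩
  smul_mem' := by
    rintro c x ⟨hx, hx'⟩
    refine ⟨Submodule.smul_mem _ c hx, ?_⟩
    have := A.op.adjointMulSelf.map_smul c ⟨x, hx⟩
    rw [hx', smul_comm] at this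
    exact this

theorem mem_adjoint_domain {x : X} : x ∈ A.op.adjoint.domain ↔ x ∈ A.op.domain := by
  rw [A.skew]; rfl

theorem adjoint_apply {x : X} (h : x ∈ A.op.adjoint.domain) :
    A.op.adjoint ⟨x, h⟩ = -A.op ⟨x, A.mem_adjoint_domain.1 h⟩ := by
  have key : ∀ (B : X →ₗ.[ℝ] X) (_ : B = -A.op) (h : x ∈ B.domain) (h' : x ∈ A.op.domain),
      B ⟨x, h⟩ = -A.op ⟨x, h'⟩ := by
    rintro B rfl h h'
    rfl
  exact key _ A.skew _ _

theorem adjointMulSelf_apply (x : A.op.adjointMulSelf.domain) :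
    A.op.adjointMulSelf x = A.op.adjoint ⟨A.op ⟨x.1, x.2.1⟩, x.2.2⟩ := rfl

theorem inner_adjointMulSelf (x : A.op.adjointMulSelf.domain) (y : A.op.domain) :
    inner ℝ (A.op.adjointMulSelf x) (y : X) = inner ℝ (A.op ⟨x.1, x.2.1⟩) (A.op y) := by
  rw [adjointMulSelf_apply]
  exact LinearPMap.adjoint_isFormalAdjoint A.dense_domain _ _

theorem adjointMulSelf_symm (x y : A.op.adjointMulSelf.domain) :
    inner ℝ (A.op.adjointMulSelf x) (y : X) = inner ℝ (x : X) (A.op.adjointMulSelf y) := by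
  rw [A.inner_adjointMulSelf x ⟨y.1, y.2.1⟩, real_inner_comm _ (x : X),
    A.inner_adjointMulSelf y ⟨x.1, x.2.1⟩, real_inner_comm]

theorem mem_domain_of_mem_eig {ω : ℝ≥0} {x : X} (h : x ∈ A.eig ω) : x ∈ A.op.domain := h.1.1

theorem norm_op_eig {ω : ℝ≥0} {x : X} (h : x ∈ A.eig ω) :
    ‖A.op ⟨x, A.mem_domain_of_mem_eig h⟩‖ = ω * ‖x‖ := by
  have h1 := A.inner_adjointMulSelf ⟨x, h.1⟩ ⟨x, A.mem_domain_of_mem_eig h⟩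
  rw [h.2, real_inner_self_eq_norm_sq, real_inner_smul_left, real_inner_self_eq_norm_sq,
    ← mul_pow] at h1
  exact ((sq_eq_sq₀ (by positivity) (by positivity)).1 h1).symm

theorem op_op_eig {ω : ℝ≥0} {x : X} (h : x ∈ A.eig ω) :
    ∃ h' : A.op ⟨x, A.mem_domain_of_mem_eig h⟩ ∈ A.op.domain,
      A.op ⟨A.op ⟨x, A.mem_domain_of_mem_eig h⟩, h'⟩ = -(((ω : ℝ) ^ 2) • x) := by
  refine ⟨A.mem_adjoint_domain.1 h.1.2, ?_⟩
  have h1 := h.2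
  rw [adjointMulSelf_apply, adjoint_apply] at h1
  rw [← h1, neg_neg]

theorem op_mem_eig {ω : ℝ≥0} {x : X} (h : x ∈ A.eig ω) :
    A.op ⟨x, A.mem_domain_of_mem_eig h⟩ ∈ A.eig ω := by
  obtain ⟨h1, h2⟩ := A.op_op_eig h
  have h3 : A.op ⟨A.op ⟨x, A.mem_domain_of_mem_eig h⟩, h1⟩ ∈ A.op.domain := by
    rw [h2]
    exact Submodule.neg_mem _ (Submodule.smul_mem _ _ (A.mem_domain_of_mem_eig h))
  refine ⟨⟨h1, A.mem_adjoint_domain.2 h3⟩, ?_⟩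
  rw [adjointMulSelf_apply, adjoint_apply]
  have h4 : (⟨A.op ⟨A.op ⟨x, A.mem_domain_of_mem_eig h⟩, h1⟩, h3⟩ : A.op.domain)
      = (-((ω : ℝ) ^ 2)) • ⟨x, A.mem_domain_of_mem_eig h⟩ := by
    apply Subtype.ext
    simp [h2]
  rw [h4, LinearPMap.map_smul, neg_smul, neg_neg]

/-- The restriction of `A` to the eigenspace `eig ω`, which it leaves invariant. -/
def opEig (ω : ℝ≥0) : A.eig ω →ₗ[ℝ] A.eig ω where
  toFun x := ⟨A.op ⟨x.1, A.mem_domain_of_mem_eig x.2⟩, A.op_mem_eig x.2⟩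
  map_add' x y := Subtype.ext (A.op.map_add ⟨x.1, A.mem_domain_of_mem_eig x.2⟩
    ⟨y.1, A.mem_domain_of_mem_eig y.2⟩)
  map_smul' c x := Subtype.ext (A.op.map_smul c ⟨x.1, A.mem_domain_of_mem_eig x.2⟩)

theorem norm_opEig {ω : ℝ≥0} (x : A.eig ω) : ‖A.opEig ω x‖ = ω * ‖x‖ := A.norm_op_eig x.2

theorem orthogonalFamily_eig :
    OrthogonalFamily ℝ (fun ω => A.eig ω) fun ω => (A.eig ω).subtypeₗᵢ := by
  intro ω ν hne x y
  have h1 := A.adjointMulSelf_symm ⟨x.1, x.2.1⟩ ⟨y.1, y.2.1⟩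
  rw [x.2.2, y.2.2, real_inner_smul_left, real_inner_smul_right] at h1
  have h2 : ((ω : ℝ) ^ 2 - (ν : ℝ) ^ 2) * inner ℝ (x : X) (y : X) = 0 := by linarith
  rcases mul_eq_zero.1 h2 with h | h
  · refine absurd ?_ hne
    have : (ω : ℝ) = ν := (sq_eq_sq₀ ω.2 ν.2).1 (sub_eq_zero.1 h)
    exact_mod_cast this
  · exact h

/-- Eigenvectors of `A* A` in terms of a resolvent. -/
theorem mem_eig_iff {z : ℝ} {R : X →L[ℝ] X}
    (h1 : ∀ x : X, ∃ h : R x ∈ A.op.adjointMulSelf.domain,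
      z • R x - A.op.adjointMulSelf ⟨R x, h⟩ = x)
    (h2 : ∀ x : A.op.adjointMulSelf.domain, R (z • (x : X) - A.op.adjointMulSelf x) = x)
    {ω : ℝ≥0} {x : X} : x ∈ A.eig ω ↔ (z - (ω : ℝ) ^ 2) • R x = x := by
  constructor
  · rintro ⟨h, h'⟩
    have := h2 ⟨x, h⟩
    rwa [h', ← sub_smul, map_smul] at this
  · intro h
    obtain ⟨hR, hR'⟩ := h1 x
    have hx : x ∈ A.op.adjointMulSelf.domain := by
      rw [← h]; exact Submodule.smul_mem _ _ hR
    refine ⟨hx, ?_⟩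
    have h4 : (⟨x, hx⟩ : A.op.adjointMulSelf.domain) = (z - (ω : ℝ) ^ 2) • ⟨R x, hR⟩ :=
      Subtype.ext h.symm
    rw [h4, LinearPMap.map_smul]
    have h5 : A.op.adjointMulSelf ⟨R x, hR⟩ = z • R x - x := by
      rw [← sub_eq_iff_eq_add'.2 (sub_eq_iff_eq_add.1 hR')]
    rw [h5, smul_sub, smul_comm, h]
    module

instance completeSpace_eig (ω : ℝ≥0) : CompleteSpace (A.eig ω) := by
  obtain ⟨z, R, -, h1, h2⟩ := A.compact_resolvent
  have : IsClosed (A.eig ω : Set X) := by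
    have : (A.eig ω : Set X) = {x | (z - (ω : ℝ) ^ 2) • R x = x} :=
      Set.ext fun x => A.mem_eig_iff h1 h2
    rw [this]
    exact isClosed_eq (by fun_prop) continuous_id
  exact this.completeSpace_coe

/-- The spectral theorem: `X` is the Hilbert sum of the eigenspaces of `A* A`. -/
theorem isHilbertSum_eig :
    IsHilbertSum ℝ (fun ω => A.eig ω) fun ω => (A.eig ω).subtypeₗᵢ := by
  refine IsHilbertSum.mkInternal (F := fun ω => A.eig ω) A.orthogonalFamily_eig ?_
  obtain ⟨z, R, hR, h1, h2⟩ := A.compact_resolvent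
  have hsymm : R.IsSymmetric := by
    intro x y
    obtain ⟨hx, hx'⟩ := h1 x
    obtain ⟨hy, hy'⟩ := h1 y
    have h3 := A.adjointMulSelf_symm ⟨R x, hx⟩ ⟨R y, hy⟩
    change inner ℝ (R x) y = inner ℝ x (R y)
    conv_lhs => rw [← hy']
    conv_rhs => rw [← hx']
    rw [inner_sub_left, inner_sub_right, real_inner_smul_left, real_inner_smul_right, h3]
  have h3 := ContinuousLinearMap.orthogonalComplement_iSup_eigenspaces_eq_bot hR hsymm
  have h4 : (⨆ μ, Module.End.eigenspace (R : Module.End ℝ X) μ) ≤ ⨆ ω, A.eig ω := by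
    refine iSup_le fun μ x hx => ?_
    rw [Module.End.mem_eigenspace_iff] at hx
    replace hx : R x = μ • x := hx
    by_cases hx0 : x = 0
    · rw [hx0]; exact Submodule.zero_mem _
    obtain ⟨hRx, hRx'⟩ := h1 x
    have hμ : μ ≠ 0 := by
      rintro rfl
      rw [zero_smul] at hx
      have : (⟨R x, hRx⟩ : A.op.adjointMulSelf.domain) = 0 := Subtype.ext hx
      rw [this, LinearPMap.map_zero, hx, smul_zero, sub_zero] at hRx'
      exact hx0 hRx'.symm
    have hxd : x ∈ A.op.adjointMulSelf.domain := by
      have : x = μ⁻¹ • R x := by rw [hx, smul_smul, inv_mul_cancel₀ hμ, one_smul]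
      rw [this]; exact Submodule.smul_mem _ _ hRx
    have h5 : (⟨R x, hRx⟩ : A.op.adjointMulSelf.domain) = μ • ⟨x, hxd⟩ := Subtype.ext hx
    have h6 : A.op.adjointMulSelf ⟨x, hxd⟩ = (z - μ⁻¹) • x := by
      rw [h5, LinearPMap.map_smul, hx] at hRx'
      have h7 : μ⁻¹ • (z • μ • x - μ • A.op.adjointMulSelf ⟨x, hxd⟩) = μ⁻¹ • x := by rw [hRx']
      rw [smul_comm z μ x, ← smul_sub, smul_smul, inv_mul_cancel₀ hμ, one_smul] at h7
      rw [sub_smul, ← h7, sub_sub_cancel]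
    have h8 : 0 ≤ z - μ⁻¹ := by
      have h9 := A.inner_adjointMulSelf ⟨x, hxd⟩ ⟨x, hxd.1⟩
      rw [h6, real_inner_smul_left, real_inner_self_eq_norm_sq, real_inner_self_eq_norm_sq] at h9
      have hpos : 0 < ‖x‖ ^ 2 := by positivity
      by_contra hneg
      have : (z - μ⁻¹) * ‖x‖ ^ 2 < 0 := mul_neg_of_neg_of_pos (not_le.1 hneg) hpos
      have h10 := sq_nonneg ‖A.op ⟨x, hxd.1⟩‖
      linarith
    refine Submodule.mem_iSup_of_mem (Real.toNNReal √(z - μ⁻¹)) ⟨hxd, ?_⟩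
    rw [h6, Real.coe_toNNReal _ (Real.sqrt_nonneg _), Real.sq_sqrt h8]
  rw [top_le_iff, Submodule.topologicalClosure_eq_top_iff, eq_bot_iff, ← h3]
  exact Submodule.orthogonal_le h4

/-- The spectral decomposition `x ↦ (P_ω x)_ω`, where `P_ω` is the orthogonal projection onto
`eig ω`, as an isometry of `X` onto the Hilbert sum of the eigenspaces; its inverse is
`(v_ω)_ω ↦ ∑ v_ω`. -/
def spec : X ≃ₗᵢ[ℝ] lp (fun ω => A.eig ω) 2 := A.isHilbertSum_eig.linearIsometryEquiv

/-! ### The scale of spaces `X^σ = D((A* A)^{σ/2})` -/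

/-- `X^σ = D((A* A)^{σ/2})` (for `σ ≥ 0`) as a subspace of `X`: the `x` such that
`∑_ω (1 + ω²)^σ ‖P_ω x‖² < ∞`. -/
def scaleSubmodule (σ : ℝ) : Submodule ℝ X where
  carrier := {x | Memℓp (fun ω : ℝ≥0 => (1 + (ω : ℝ) ^ 2) ^ (σ / 2) • A.spec x ω) 2}
  add_mem' := by
    intro x y hx hy
    have := Memℓp.add hx hy
    simpa only [Set.mem_ofPred_eq, map_add, lp.coeFn_add, Pi.add_apply, smul_add, Pi.add_def]
      using this
  zero_mem' := by
    have := zero_memℓp (E := fun ω => A.eig ω) (p := 2)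
    simpa only [Set.mem_ofPred_eq, map_zero, lp.coeFn_zero, Pi.zero_apply, smul_zero, Pi.zero_def]
      using this
  smul_mem' := by
    intro c x hx
    have := Memℓp.const_smul hx c
    have e : (fun ω : ℝ≥0 => (1 + (ω : ℝ) ^ 2) ^ (σ / 2) • A.spec (c • x) ω)
        = c • fun ω : ℝ≥0 => (1 + (ω : ℝ) ^ 2) ^ (σ / 2) • A.spec x ω := by
      funext ω
      rw [map_smul, lp.coeFn_smul, Pi.smul_apply, Pi.smul_apply, smul_comm]
    simpa only [Set.mem_ofPred_eq, e] using this

/-- The Hilbert space `X^σ`, with the norm `‖x‖² = ∑_ω (1 + ω²)^σ ‖P_ω x‖²`. -/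
def Scale (σ : ℝ) : Type _ := A.scaleSubmodule σ

variable {A}

instance (σ : ℝ) : AddCommGroup (A.Scale σ) :=
  inferInstanceAs (AddCommGroup (A.scaleSubmodule σ))

instance (σ : ℝ) : Module ℝ (A.Scale σ) :=
  inferInstanceAs (Module ℝ (A.scaleSubmodule σ))

/-- The inclusion `X^σ ⊆ X`. -/
def Scale.val {σ : ℝ} : A.Scale σ →ₗ[ℝ] X := (A.scaleSubmodule σ).subtype

theorem Scale.val_injective {σ : ℝ} : Function.Injective (Scale.val : A.Scale σ → X) :=
  Subtype.val_injective

/-- The weighted spectral decomposition `x ↦ ((1 + ω²)^{σ/2} P_ω x)_ω` of `x ∈ X^σ`. -/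
def Scale.weighted {σ : ℝ} : A.Scale σ →ₗ[ℝ] lp (fun ω => A.eig ω) 2 where
  toFun x := ⟨fun ω : ℝ≥0 => (1 + (ω : ℝ) ^ 2) ^ (σ / 2) • A.spec x.val ω, x.2⟩
  map_add' x y := by
    apply lp.ext
    funext ω
    change (1 + (ω : ℝ) ^ 2) ^ (σ / 2) • A.spec (x + y).val ω =
      (1 + (ω : ℝ) ^ 2) ^ (σ / 2) • A.spec x.val ω + (1 + (ω : ℝ) ^ 2) ^ (σ / 2) • A.spec y.val ω
    rw [map_add, map_add, lp.coeFn_add, Pi.add_apply, smul_add]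
  map_smul' c x := by
    apply lp.ext
    funext ω
    change (1 + (ω : ℝ) ^ 2) ^ (σ / 2) • A.spec (c • x).val ω =
      c • (1 + (ω : ℝ) ^ 2) ^ (σ / 2) • A.spec x.val ω
    rw [map_smul, map_smul, lp.coeFn_smul, Pi.smul_apply, smul_comm]

theorem Scale.weighted_injective {σ : ℝ} :
    Function.Injective (Scale.weighted : A.Scale σ → lp (fun ω => A.eig ω) 2) := by
  intro x y h
  apply Scale.val_injective
  apply A.spec.injective
  ext1
  funext ω
  have h1 := congrFun (congrArg (fun f : lp (fun ω => A.eig ω) 2 => (f : ∀ ω, A.eig ω)) h) ω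
  have h2 : (1 + (ω : ℝ) ^ 2) ^ (σ / 2) ≠ 0 := (Real.rpow_pos_of_pos (by positivity) _).ne'
  exact smul_right_injective _ h2 h1

instance (σ : ℝ) : NormedAddCommGroup (A.Scale σ) :=
  NormedAddCommGroup.induced (A.Scale σ) (lp (fun ω => A.eig ω) 2) Scale.weighted
    Scale.weighted_injective

instance (σ : ℝ) : InnerProductSpace ℝ (A.Scale σ) :=
  InnerProductSpace.induced (𝕜 := ℝ) (E := lp (fun ω => A.eig ω) 2)
    (Scale.weighted : A.Scale σ →ₗ[ℝ] lp (fun ω => A.eig ω) 2)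

variable (A)

/-- The inclusion `X^σ ⊆ X^τ` for `τ ≤ σ`. -/
def incl {τ σ : ℝ} (h : τ ≤ σ) : A.Scale σ →ₗ[ℝ] A.Scale τ :=
  Submodule.inclusion (p := A.scaleSubmodule σ) (p' := A.scaleSubmodule τ) (by
    intro x hx
    refine Memℓp.mono' hx fun ω => ?_
    rw [norm_smul, norm_smul]
    refine mul_le_mul_of_nonneg_right ?_ (norm_nonneg _)
    have h1 : (1 : ℝ) ≤ 1 + (ω : ℝ) ^ 2 := by nlinarith [sq_nonneg (ω : ℝ)]
    rw [Real.norm_of_nonneg (by positivity), Real.norm_of_nonneg (by positivity)]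
    exact Real.rpow_le_rpow_of_exponent_le h1 (by linarith))

/-! ### The group `e^{tA}` and the powers `(A* A)^s` -/

/-- `e^{tA}` on the eigenspace `eig ω`: there `A² = -ω²`, so that
`e^{tA} = cos (ω t) + (sin (ω t) / ω) A` (and `e^{tA} = 1` if `ω = 0`, since `A = 0` there). -/
def expEig (t : ℝ) (ω : ℝ≥0) (v : A.eig ω) : A.eig ω :=
  Real.cos (ω * t) • v + (Real.sin (ω * t) / ω) • A.opEig ω v

theorem norm_expEig_le (t : ℝ) (ω : ℝ≥0) (v : A.eig ω) : ‖A.expEig t ω v‖ ≤ 2 * ‖v‖ := by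
  have h1 : ‖Real.cos (ω * t) • v‖ ≤ ‖v‖ := by
    rw [norm_smul, Real.norm_eq_abs]
    exact mul_le_of_le_one_left (norm_nonneg _) (Real.abs_cos_le_one _)
  have h2 : ‖(Real.sin (ω * t) / ω) • A.opEig ω v‖ ≤ ‖v‖ := by
    rw [norm_smul, Real.norm_eq_abs, norm_opEig, abs_div, NNReal.abs_eq]
    rcases eq_or_ne (ω : ℝ) 0 with h | h
    · simp [h]
    · rw [← mul_assoc, div_mul_cancel₀ _ h]
      exact mul_le_of_le_one_left (norm_nonneg _) (Real.abs_sin_le_one _)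
  calc ‖A.expEig t ω v‖ ≤ _ := norm_add_le _ _
    _ ≤ 2 * ‖v‖ := by linarith

theorem expEig_smul (t : ℝ) (ω : ℝ≥0) (c : ℝ) (v : A.eig ω) :
    A.expEig t ω (c • v) = c • A.expEig t ω v := by
  simp only [expEig, map_smul, smul_add, smul_comm c]

theorem memℓp_expEig (t : ℝ) {f : ∀ ω, A.eig ω} (hf : Memℓp f 2) :
    Memℓp (fun ω => A.expEig t ω (f ω)) 2 := by
  refine Memℓp.mono' (Memℓp.const_smul hf (2 : ℝ)) fun ω => ?_
  rw [Pi.smul_apply, norm_smul, Real.norm_of_nonneg (by norm_num)]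
  exact A.norm_expEig_le t ω _

/-- The unitary group `e^{tA}` on `X`. -/
def exp (t : ℝ) (x : X) : X :=
  A.spec.symm ⟨fun ω => A.expEig t ω (A.spec x ω), A.memℓp_expEig t (lp.memℓp _)⟩

theorem spec_exp (t : ℝ) (x : X) (ω : ℝ≥0) :
    A.spec (A.exp t x) ω = A.expEig t ω (A.spec x ω) := by
  rw [exp, LinearIsometryEquiv.apply_symm_apply]

/-- The group `e^{tA}` on `X^σ`. -/
def expScale {σ : ℝ} (t : ℝ) (x : A.Scale σ) : A.Scale σ :=
  ⟨A.exp t x.val, by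
    have h := A.memℓp_expEig t x.2
    have e : (fun ω : ℝ≥0 => (1 + (ω : ℝ) ^ 2) ^ (σ / 2) • A.spec (A.exp t x.val) ω) =
        fun ω : ℝ≥0 => A.expEig t ω ((1 + (ω : ℝ) ^ 2) ^ (σ / 2) • A.spec x.val ω) := by
      funext ω
      rw [spec_exp, expEig_smul]
    change Memℓp (fun ω : ℝ≥0 => (1 + (ω : ℝ) ^ 2) ^ (σ / 2) • A.spec (A.exp t x.val) ω) 2
    rw [e]
    exact h⟩

theorem memℓp_pow {σ s : ℝ} (hs : 0 ≤ s) (x : A.Scale (σ + 2 * s)) :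
    Memℓp (fun ω : ℝ≥0 => (1 + (ω : ℝ) ^ 2) ^ (σ / 2) •
      ((ω : ℝ) ^ (2 * s) • A.spec x.val ω)) 2 := by
  refine Memℓp.mono' x.2 fun ω => ?_
  rw [norm_smul, norm_smul, norm_smul, ← mul_assoc]
  refine mul_le_mul_of_nonneg_right ?_ (norm_nonneg _)
  have h0 : (0 : ℝ) < 1 + (ω : ℝ) ^ 2 := by positivity
  rw [Real.norm_of_nonneg (by positivity), Real.norm_of_nonneg (by positivity),
    Real.norm_of_nonneg (by positivity)]
  have h1 : (ω : ℝ) ^ (2 * s) ≤ (1 + (ω : ℝ) ^ 2) ^ s := by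
    rw [Real.rpow_mul (NNReal.coe_nonneg ω)]
    refine Real.rpow_le_rpow (by positivity) ?_ hs
    rw [Real.rpow_two]
    linarith
  calc (1 + (ω : ℝ) ^ 2) ^ (σ / 2) * (ω : ℝ) ^ (2 * s)
      ≤ (1 + (ω : ℝ) ^ 2) ^ (σ / 2) * (1 + (ω : ℝ) ^ 2) ^ s := by gcongr
    _ = (1 + (ω : ℝ) ^ 2) ^ ((σ + 2 * s) / 2) := by
        rw [← Real.rpow_add h0]; congr 1; ring

theorem memℓp_of_memℓp_weighted {σ : ℝ} (hσ : 0 ≤ σ) {f : ∀ ω, A.eig ω}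
    (hf : Memℓp (fun ω : ℝ≥0 => (1 + (ω : ℝ) ^ 2) ^ (σ / 2) • f ω) 2) : Memℓp f 2 := by
  refine Memℓp.mono' hf fun ω => ?_
  rw [norm_smul]
  refine le_mul_of_one_le_left (norm_nonneg _) ?_
  rw [Real.norm_of_nonneg (by positivity)]
  exact Real.one_le_rpow (by nlinarith [sq_nonneg (ω : ℝ)]) (by linarith)

/-- The operator `(A* A)^s : X^{σ + 2s} → X^σ`, which acts as `ω^{2s}` on `eig ω`. -/
def absPow {σ s : ℝ} (hσ : 0 ≤ σ) (hs : 0 ≤ s) (x : A.Scale (σ + 2 * s)) : A.Scale σ :=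
  ⟨A.spec.symm ⟨fun ω : ℝ≥0 => (ω : ℝ) ^ (2 * s) • A.spec x.val ω,
      A.memℓp_of_memℓp_weighted hσ (A.memℓp_pow hs x)⟩, by
    change Memℓp (fun ω : ℝ≥0 => (1 + (ω : ℝ) ^ 2) ^ (σ / 2) • A.spec (A.spec.symm _) ω) 2
    rw [LinearIsometryEquiv.apply_symm_apply]
    exact A.memℓp_pow hs x⟩

end SkewAdjointOp

end Operators

/-! ### Complexification -/

/-- The complexification `Y_ℂ` of a real Hilbert space `Y`: the elements `y₁ + i y₂` with
`y₁, y₂ ∈ Y`, and the norm `‖y₁ + i y₂‖² = ‖y₁‖² + ‖y₂‖²`. -/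
def Complexified (Y : Type*) : Type _ := WithLp 2 (Y × Y)

namespace Complexified

variable {Y : Type*}

/-- The element `y₁ + i y₂`. -/
def mk (y₁ y₂ : Y) : Complexified Y := WithLp.toLp 2 (y₁, y₂)

/-- The real part. -/
def re (y : Complexified Y) : Y := WithLp.fst y

/-- The imaginary part. -/
def im (y : Complexified Y) : Y := WithLp.snd y

theorem ext {x y : Complexified Y} (h₁ : x.re = y.re) (h₂ : x.im = y.im) : x = y :=
  (WithLp.ofLp_injective 2) (Prod.ext h₁ h₂)

variable [NormedAddCommGroup Y]

instance : NormedAddCommGroup (Complexified Y) :=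
  inferInstanceAs (NormedAddCommGroup (WithLp 2 (Y × Y)))

/-- The element `y + i 0`. -/
def ofReal (y : Y) : Complexified Y := mk y 0

theorem norm_sq_eq (y : Complexified Y) : ‖y‖ ^ 2 = ‖y.re‖ ^ 2 + ‖y.im‖ ^ 2 :=
  WithLp.prod_norm_sq_eq_of_L2 y

theorem re_add (x y : Complexified Y) : (x + y).re = x.re + y.re := rfl

theorem im_add (x y : Complexified Y) : (x + y).im = x.im + y.im := rfl

theorem re_zero : (0 : Complexified Y).re = 0 := rfl

theorem im_zero : (0 : Complexified Y).im = 0 := rfl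

variable [InnerProductSpace ℝ Y]

instance : SMul ℂ (Complexified Y) :=
  ⟨fun c y => mk (c.re • y.re - c.im • y.im) (c.re • y.im + c.im • y.re)⟩

theorem re_smul (c : ℂ) (y : Complexified Y) : (c • y).re = c.re • y.re - c.im • y.im := rfl

theorem im_smul (c : ℂ) (y : Complexified Y) : (c • y).im = c.re • y.im + c.im • y.re := rfl

instance : Module ℂ (Complexified Y) where
  one_smul y := ext (by simp [re_smul]) (by simp [im_smul])
  mul_smul a b y := by
    apply ext <;> simp only [re_smul, im_smul, Complex.mul_re, Complex.mul_im] <;> module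
  smul_zero a := ext (by simp [re_smul, re_zero, im_zero]) (by simp [im_smul, re_zero, im_zero])
  smul_add a x y := by
    apply ext <;> simp only [re_smul, im_smul, re_add, im_add] <;> module
  add_smul a b y := by
    apply ext <;> simp only [re_smul, im_smul, re_add, im_add, Complex.add_re, Complex.add_im] <;>
      module
  zero_smul y := ext (by simp [re_smul, re_zero]) (by simp [im_smul, im_zero])

instance : NormedSpace ℂ (Complexified Y) where
  norm_smul_le c y := by
    refine le_of_sq_le_sq ?_ (by positivity)
    rw [mul_pow, norm_sq_eq, norm_sq_eq, re_smul, im_smul, norm_sub_sq_real, norm_add_sq_real,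
      Complex.sq_norm, Complex.normSq_apply]
    simp only [norm_smul, real_inner_smul_left, real_inner_smul_right, mul_pow, Real.norm_eq_abs,
      sq_abs]
    rw [real_inner_comm y.im y.re]
    apply le_of_eq
    ring

/-- The cylinder `{y ∈ Y_ℂ | ‖Re y‖ ≤ M, ‖Im y‖ ≤ δ}`. -/
def cylinder (Y : Type*) [NormedAddCommGroup Y] [InnerProductSpace ℝ Y] (M δ : ℝ) :
    Set (Complexified Y) :=
  {y | ‖y.re‖ ≤ M ∧ ‖y.im‖ ≤ δ}

end Complexified

/-! ### The assumptions on the observation operator, the nonlinearity and the sources -/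

namespace SkewAdjointOp

open MeasureTheory

variable {X : Type*} [NormedAddCommGroup X] [InnerProductSpace ℝ X] [CompleteSpace X]
  (A : SkewAdjointOp X)

/-- `e^{tA}` is observable on `[0, T]` in `X^σ` through the bounded operator `C`. -/
def IsObservable {σ : ℝ} (C : A.Scale σ →L[ℝ] A.Scale σ) (T : ℝ) : Prop :=
  ∃ K : ℝ, 0 < K ∧ ∀ W : A.Scale σ,
    ‖W‖ ^ 2 ≤ K ^ 2 * ∫ t in (0 : ℝ)..T, ‖C (A.expScale t W)‖ ^ 2

/-- `C ∈ L(X^σ)` observes `e^{tA}` on `[0, T]` in `X^σ`; moreover `C` restricts to a bounded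
operator on `X^{σ+ε}` which observes `e^{tA}` on `[0, T]` in `X^{σ+ε}`. -/
def IsObservation {σ ε : ℝ} (hε : 0 < ε) (C : A.Scale σ →L[ℝ] A.Scale σ) (T : ℝ) : Prop :=
  A.IsObservable C T ∧
  ∃ C' : A.Scale (σ + ε) →L[ℝ] A.Scale (σ + ε),
    (∀ x, (C' x).val = (C (A.incl (le_add_of_nonneg_right hε.le) x)).val) ∧ A.IsObservable C' T

/-- For some `s > 0`, the commutator `[(A* A)^s, C]` belongs to `L(X^{σ+2s}, X^{σ+ε})`.
For `x ∈ X^{σ+2s}`, the vector `C x` is only known to lie in `X^σ`, so that `(A* A)^s C x` lies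
in `X^{σ-2s}`, and the order `σ - 2s` may be negative. An element of a space of the scale, of any
real order, is determined by its components in the eigenspaces, and `(A* A)^s` multiplies the
component in `eig ω` by `ω^{2s}`; so the identity `K x = (A* A)^s C x - C (A* A)^s x` is written
component by component. -/
def CommutatorBounded {σ : ℝ} (hσ : 0 ≤ σ) (ε : ℝ) (C : A.Scale σ →L[ℝ] A.Scale σ) : Prop :=
  ∃ (s : ℝ) (hs : 0 < s) (K : A.Scale (σ + 2 * s) →L[ℝ] A.Scale (σ + ε)),
    ∀ (x : A.Scale (σ + 2 * s)) (ω : ℝ≥0),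
      A.spec (K x).val ω =
        (ω : ℝ) ^ (2 * s) • A.spec (C (A.incl (by linarith) x)).val ω
          - A.spec (C (A.absPow hσ hs.le x)).val ω

/-- `F` is bounded and Lipschitz from the ball of radius `M` of `X^σ` to `X^{σ+ε}`, and has, for
some `δ > 0`, an extension to the cylinder `{‖Re‖ ≤ M, ‖Im‖ ≤ 2δ}` of `X^σ_ℂ`, with values in
`X^{σ+ε}_ℂ`, holomorphic in the interior of the cylinder, and bounded and Lipschitz on the
cylinder. -/
def IsHolomorphicNonlinearity {σ ε : ℝ} (F : A.Scale σ → A.Scale (σ + ε)) (M : ℝ) : Prop :=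
  (∃ c : ℝ, 0 < c ∧
    (∀ u, ‖u‖ ≤ M → ‖F u‖ ≤ c) ∧
    ∀ u v, ‖u‖ ≤ M → ‖v‖ ≤ M → ‖F u - F v‖ ≤ c * ‖u - v‖) ∧
  ∃ δ : ℝ, 0 < δ ∧ ∃ F' : Complexified (A.Scale σ) → Complexified (A.Scale (σ + ε)),
    (∀ u, ‖u‖ ≤ M → F' (.ofReal u) = .ofReal (F u)) ∧
    DifferentiableOn ℂ F' (interior (Complexified.cylinder (A.Scale σ) M (2 * δ))) ∧
    ∃ c : ℝ, 0 < c ∧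
      (∀ u ∈ Complexified.cylinder (A.Scale σ) M (2 * δ), ‖F' u‖ ≤ c) ∧
      ∀ u ∈ Complexified.cylinder (A.Scale σ) M (2 * δ),
        ∀ v ∈ Complexified.cylinder (A.Scale σ) M (2 * δ), ‖F' u - F' v‖ ≤ c * ‖u - v‖

/-- `H' : ℂ → Y_ℂ` is a continuous extension of `H : [0, T'] → Y` to the closed rectangle
`[0, T'] + i[-μ, μ]`, holomorphic in the open rectangle. -/
def _root_.IsHolomorphicExtension {Y : Type*} [NormedAddCommGroup Y] [InnerProductSpace ℝ Y]
    (H : ℝ → Y) (H' : ℂ → Complexified Y) (T' μ : ℝ) : Prop :=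
  ContinuousOn H' (Set.Icc 0 T' ×ℂ Set.Icc (-μ) μ) ∧
  DifferentiableOn ℂ H' (Set.Ioo 0 T' ×ℂ Set.Ioo (-μ) μ) ∧
  ∀ t ∈ Set.Icc 0 T', H' (t : ℂ) = .ofReal (H t)

/-- `U ∈ C⁰([0, T'], X^σ)` is a mild solution of `∂ₜ U = A U + F(U + H₁) + H₂` on `[0, T']`:
`U(t) = e^{tA} U(0) + ∫₀ᵗ e^{(t-r)A} (F(U(r) + H₁(r)) + H₂(r)) dr`, an identity in `X`. -/
def IsMildSolution {σ ε : ℝ} (F : A.Scale σ → A.Scale (σ + ε)) (H₁ : ℝ → A.Scale σ)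
    (H₂ : ℝ → A.Scale (σ + ε)) (T' : ℝ) (U : ℝ → A.Scale σ) : Prop :=
  ContinuousOn U (Set.Icc 0 T') ∧
  ∀ t ∈ Set.Icc 0 T', (U t).val = A.exp t (U 0).val +
    ∫ r in (0 : ℝ)..t, A.exp (t - r) (F (U r + H₁ r) + H₂ r).val

end SkewAdjointOp

end

/-! The translates of the solution are made to depend holomorphically on a complex shift. Fix a
window `[z, z + T]` inside the open time interval and put `v_l(s, θ) = U(z + l s + T θ)` on the unit
square. Let `P` be the projection onto the frequencies `ω ≤ n`, let `Q = 1 - P`, and let `γ_l` be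
the translate of the forcing `F(U + H₁) + H₂`.

On low frequencies `A` is bounded, so `P v_l = P v_0 + l ∫₀ˢ (A P v_l + P γ_l)`. The variable `s` is
there so that the shift `l` enters only as a scalar factor, which may be complex. On high
frequencies, Duhamel's formula in `θ` gives `Q v_l` up to a free solution with unknown initial
value. Since `C v_l = 0`, observability recovers that free solution: with `R` the reconstruction
operator obtained by inverting the observability Gramian (`OrthogonalGroup.exists_reconstruction`),
one gets `v_l = (1 - R C)(P v_l + Duhamel(Q γ_l))` (`OrthogonalGroup.window_mild_eq`).

This is a fixed point equation `v = α + l (β₂ v + β₃ Γ(l, v)) + β₄ Γ(l, v)` in the continuous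
functions on the square, where `Γ(l, v) = F(v + H₁) + H₂` along the shifted window. The operators
`R` and Duhamel do not depend on `n`, while `β₄` contains `Q` composed with the inclusion of
`X^{σ+ε}` into `X^σ`, which is small for large `n`: the gain of `ε` derivatives in `F` makes `β₄ Γ`
a contraction. The operators `β₂` and `β₃` may then be large, but they carry the factor `l`. After
complexification the equation is thus a contraction for small complex `l`, and its solution is
holomorphic in `l` (`exists_differentiableOn_fixedPoint_affine`). For real `l` it coincides with
`v_l` by uniqueness, and evaluating at `s = 1` gives analyticity at `z + T θ`
(`OrthogonalGroup.analyticAt_mild`). -/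

/-- A strongly continuous group of uniformly bounded operators with `(e^t)* = e^{-t}`. -/
structure OrthogonalGroup (H : Type*) [NormedAddCommGroup H] [InnerProductSpace ℝ H] where
  /-- the operator at time `t` -/
  op : ℝ → H →L[ℝ] H
  op_zero : op 0 = ContinuousLinearMap.id ℝ H
  op_add : ∀ s t, op (s + t) = (op s).comp (op t)
  norm_le : ∀ t x, ‖op t x‖ ≤ 2 * ‖x‖
  continuous_op : ∀ x, Continuous fun t => op t x
  inner_op : ∀ t x y, inner ℝ (op t x) y = inner ℝ x (op (-t) y)

/-! ### The group on the scale `X^σ`, acting componentwise on the eigenspaces. -/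

namespace SkewAdjointOp

variable {X : Type*} [NormedAddCommGroup X] [InnerProductSpace ℝ X] [CompleteSpace X]
  (A : SkewAdjointOp X)

/-- The weighted spectral decomposition, as an isometry of `X^σ` onto the Hilbert sum. -/
noncomputable def weightedEquiv {σ : ℝ} (hσ : 0 ≤ σ) :
    A.Scale σ ≃ₗᵢ[ℝ] lp (fun ω => A.eig ω) 2 where
  toLinearEquiv := LinearEquiv.ofBijective Scale.weighted ⟨Scale.weighted_injective, by
    intro f
    have hw : ∀ ω : ℝ≥0, (1 + (ω : ℝ) ^ 2) ^ (σ / 2) ≠ 0 := fun ω =>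
      (Real.rpow_pos_of_pos (by positivity) _).ne'
    have e : (fun ω : ℝ≥0 => (1 + (ω : ℝ) ^ 2) ^ (σ / 2) •
        ((1 + (ω : ℝ) ^ 2) ^ (σ / 2))⁻¹ • f ω) = f := by
      funext ω
      rw [smul_inv_smul₀ (hw ω)]
    have h1 : Memℓp (fun ω : ℝ≥0 => ((1 + (ω : ℝ) ^ 2) ^ (σ / 2))⁻¹ • f ω) 2 := by
      refine A.memℓp_of_memℓp_weighted hσ ?_
      rw [e]
      exact lp.memℓp f
    refine ⟨⟨A.spec.symm ⟨_, h1⟩, ?_⟩, ?_⟩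
    · change Memℓp (fun ω : ℝ≥0 => (1 + (ω : ℝ) ^ 2) ^ (σ / 2) • A.spec (A.spec.symm _) ω) 2
      rw [LinearIsometryEquiv.apply_symm_apply]
      change Memℓp (fun ω : ℝ≥0 => (1 + (ω : ℝ) ^ 2) ^ (σ / 2) •
        ((1 + (ω : ℝ) ^ 2) ^ (σ / 2))⁻¹ • f ω) 2
      rw [e]
      exact lp.memℓp f
    · ext1
      funext ω
      change (1 + (ω : ℝ) ^ 2) ^ (σ / 2) • A.spec (A.spec.symm _) ω = _
      rw [LinearIsometryEquiv.apply_symm_apply]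
      exact congrFun e ω⟩
  norm_map' _ := rfl

theorem weightedEquiv_apply {σ : ℝ} (hσ : 0 ≤ σ) (x : A.Scale σ) (ω : ℝ≥0) :
    A.weightedEquiv hσ x ω = (1 + (ω : ℝ) ^ 2) ^ (σ / 2) • A.spec x.val ω := rfl

theorem completeSpace_scale {σ : ℝ} (hσ : 0 ≤ σ) : CompleteSpace (A.Scale σ) :=
  (A.weightedEquiv hσ).isometry.isUniformInducing.completeSpace_congr
    (A.weightedEquiv hσ).surjective |>.2 inferInstance

/-- The norms are weighted `ℓ²` norms, hence monotone in the components; bounds for diagonal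
operators and inclusions are therefore checked on one eigenspace at a time. -/
theorem norm_scale_le {σ τ : ℝ} {x : A.Scale σ} {y : A.Scale τ} {c : ℝ} (hc : 0 ≤ c)
    (h : ∀ ω : ℝ≥0, (1 + (ω : ℝ) ^ 2) ^ (σ / 2) * ‖A.spec x.val ω‖ ≤
      c * ((1 + (ω : ℝ) ^ 2) ^ (τ / 2) * ‖A.spec y.val ω‖)) : ‖x‖ ≤ c * ‖y‖ := by
  have h1 : ‖(Scale.weighted x : lp (fun ω => A.eig ω) 2)‖ ≤
      ‖c • (Scale.weighted y : lp (fun ω => A.eig ω) 2)‖ := by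
    refine lp.norm_mono (by norm_num) fun ω => ?_
    rw [lp.coeFn_smul, Pi.smul_apply]
    change ‖(1 + (ω : ℝ) ^ 2) ^ (σ / 2) • A.spec x.val ω‖ ≤
      ‖c • ((1 + (ω : ℝ) ^ 2) ^ (τ / 2) • A.spec y.val ω)‖
    rw [norm_smul, norm_smul, norm_smul, Real.norm_of_nonneg hc,
      Real.norm_of_nonneg (by positivity), Real.norm_of_nonneg (by positivity)]
    exact h ω
  rwa [norm_smul, Real.norm_of_nonneg hc] at h1

theorem Scale.ext_spec {σ : ℝ} {x y : A.Scale σ}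
    (h : ∀ ω, A.spec x.val ω = A.spec y.val ω) : x = y := by
  apply Scale.val_injective
  apply A.spec.injective
  ext1
  exact funext h

/-- The operator on `X^σ` acting as `d ω` on `eig ω`. -/
noncomputable def diag {σ : ℝ} (hσ : 0 ≤ σ) (d : ∀ ω, A.eig ω →ₗ[ℝ] A.eig ω) (c : ℝ)
    (hd : ∀ ω v, ‖d ω v‖ ≤ c * ‖v‖) : A.Scale σ →L[ℝ] A.Scale σ :=
  have mem : ∀ x : X, ∀ ρ : ℝ,
      Memℓp (fun ω : ℝ≥0 => (1 + (ω : ℝ) ^ 2) ^ (ρ / 2) • A.spec x ω) 2 →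
      Memℓp (fun ω : ℝ≥0 => (1 + (ω : ℝ) ^ 2) ^ (ρ / 2) • d ω (A.spec x ω)) 2 := by
    intro x ρ hx
    refine Memℓp.mono' (Memℓp.const_smul hx c) fun ω => ?_
    rw [Pi.smul_apply, ← map_smul, norm_smul c]
    exact (hd ω _).trans (mul_le_mul_of_nonneg_right (le_abs_self c) (norm_nonneg _))
  LinearMap.mkContinuous
    { toFun := fun x => ⟨A.spec.symm ⟨fun ω => d ω (A.spec x.val ω),
          A.memℓp_of_memℓp_weighted hσ (mem _ _ x.2)⟩, by
        change Memℓp (fun ω : ℝ≥0 => (1 + (ω : ℝ) ^ 2) ^ (σ / 2) • A.spec (A.spec.symm _) ω) 2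
        rw [LinearIsometryEquiv.apply_symm_apply]
        exact mem _ _ x.2⟩
      map_add' := by
        intro x y
        apply Scale.val_injective
        refine (congrArg A.spec.symm ?_).trans (map_add A.spec.symm _ _)
        ext1
        funext ω
        change d ω (A.spec (x + y).val ω) = d ω (A.spec x.val ω) + d ω (A.spec y.val ω)
        rw [map_add, map_add, lp.coeFn_add, Pi.add_apply, map_add]
      map_smul' := by
        intro r x
        apply Scale.val_injective
        refine (congrArg A.spec.symm ?_).trans (map_smul A.spec.symm _ _)
        ext1
        funext ω
        change d ω (A.spec (r • x).val ω) = r • d ω (A.spec x.val ω)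
        rw [map_smul, map_smul, lp.coeFn_smul, Pi.smul_apply, map_smul] } |c| (by
    intro x
    refine A.norm_scale_le (abs_nonneg c) fun ω => ?_
    change _ * ‖A.spec (A.spec.symm _) ω‖ ≤ _
    rw [LinearIsometryEquiv.apply_symm_apply, mul_left_comm]
    refine mul_le_mul_of_nonneg_left ?_ (by positivity)
    exact (hd ω _).trans (mul_le_mul_of_nonneg_right (le_abs_self c) (norm_nonneg _)))

theorem spec_diag {σ : ℝ} (hσ : 0 ≤ σ) (d : ∀ ω, A.eig ω →ₗ[ℝ] A.eig ω) (c : ℝ)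
    (hd : ∀ ω v, ‖d ω v‖ ≤ c * ‖v‖) (x : A.Scale σ) (ω : ℝ≥0) :
    A.spec (A.diag hσ d c hd x).val ω = d ω (A.spec x.val ω) := by
  change A.spec (A.spec.symm _) ω = _
  rw [LinearIsometryEquiv.apply_symm_apply]

theorem opEig_opEig {ω : ℝ≥0} (v : A.eig ω) :
    A.opEig ω (A.opEig ω v) = -(((ω : ℝ) ^ 2) • v) :=
  Subtype.ext (A.op_op_eig v.2).2

theorem inner_opEig {ω : ℝ≥0} (v w : A.eig ω) :
    inner ℝ (A.opEig ω v) w = -inner ℝ v (A.opEig ω w) := by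
  have h := LinearPMap.adjoint_isFormalAdjoint A.dense_domain
    ⟨(v : X), A.mem_adjoint_domain.2 (A.mem_domain_of_mem_eig v.2)⟩
    ⟨(w : X), A.mem_domain_of_mem_eig w.2⟩
  rw [adjoint_apply, inner_neg_left] at h
  have h' : -inner ℝ (A.opEig ω v) w = inner ℝ v (A.opEig ω w) := h
  rw [← h', neg_neg]

theorem opEig_zero (v : A.eig 0) : A.opEig 0 v = 0 := by
  have := A.norm_opEig v
  simpa using this

theorem expEig_add (s t : ℝ) (ω : ℝ≥0) (v : A.eig ω) :
    A.expEig (s + t) ω v = A.expEig s ω (A.expEig t ω v) := by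
  rcases eq_or_ne ω 0 with rfl | h
  · simp [expEig]
  have h' : (ω : ℝ) ≠ 0 := by exact_mod_cast h
  simp only [expEig, map_add, map_smul, opEig_opEig, mul_add, Real.cos_add, Real.sin_add]
  match_scalars <;> field_simp <;> ring

theorem inner_expEig (t : ℝ) (ω : ℝ≥0) (v w : A.eig ω) :
    inner ℝ (A.expEig t ω v) w = inner ℝ v (A.expEig (-t) ω w) := by
  simp only [expEig, inner_add_left, inner_add_right, real_inner_smul_left,
    real_inner_smul_right, inner_opEig, mul_neg, Real.cos_neg, Real.sin_neg, neg_div, neg_mul]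

theorem continuous_expEig (ω : ℝ≥0) (v : A.eig ω) : Continuous fun t => A.expEig t ω v := by
  unfold expEig
  fun_prop

/-- `expEig` as a linear map. -/
noncomputable def expEigₗ (t : ℝ) (ω : ℝ≥0) : A.eig ω →ₗ[ℝ] A.eig ω where
  toFun := A.expEig t ω
  map_add' v w := by simp only [expEig, map_add, smul_add]; abel
  map_smul' c v := A.expEig_smul t ω c v

theorem inner_scale {σ : ℝ} (x y : A.Scale σ) : inner ℝ x y =
    ∑' ω : ℝ≥0, ((1 + (ω : ℝ) ^ 2) ^ (σ / 2)) ^ 2 *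
      inner ℝ (A.spec x.val ω) (A.spec y.val ω) := by
  change inner ℝ (Scale.weighted x : lp (fun ω => A.eig ω) 2) (Scale.weighted y) = _
  rw [lp.inner_eq_tsum]
  refine tsum_congr fun ω => ?_
  change inner ℝ ((1 + (ω : ℝ) ^ 2) ^ (σ / 2) • A.spec x.val ω)
    ((1 + (ω : ℝ) ^ 2) ^ (σ / 2) • A.spec y.val ω) = _
  rw [real_inner_smul_left, real_inner_smul_right]
  ring

/-- `e^{tA}` as a bounded operator on `X^σ`. -/
noncomputable def expCLM {σ : ℝ} (hσ : 0 ≤ σ) (t : ℝ) : A.Scale σ →L[ℝ] A.Scale σ :=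
  A.diag hσ (A.expEigₗ t) 2 (A.norm_expEig_le t)

theorem spec_expCLM {σ : ℝ} (hσ : 0 ≤ σ) (t : ℝ) (x : A.Scale σ) (ω : ℝ≥0) :
    A.spec (A.expCLM hσ t x).val ω = A.expEig t ω (A.spec x.val ω) :=
  A.spec_diag hσ _ _ _ _ _

theorem expCLM_apply {σ : ℝ} (hσ : 0 ≤ σ) (t : ℝ) (x : A.Scale σ) :
    A.expCLM hσ t x = A.expScale t x := by
  refine Scale.ext_spec A fun ω => ?_
  rw [spec_expCLM]
  exact (A.spec_exp t x.val ω).symm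

theorem norm_expCLM_le {σ : ℝ} (hσ : 0 ≤ σ) (t : ℝ) (x : A.Scale σ) :
    ‖A.expCLM hσ t x‖ ≤ 2 * ‖x‖ := by
  refine A.norm_scale_le zero_le_two fun ω => ?_
  rw [spec_expCLM, mul_left_comm]
  exact mul_le_mul_of_nonneg_left (A.norm_expEig_le t ω _) (by positivity)

/-- On finitely many eigenspaces continuity is that of sine and cosine. The bound by 2, uniform in
`t`, makes the general orbit a uniform limit of such orbits; it is also why the truncation is taken
within `η / 2`. -/
theorem continuous_expCLM {σ : ℝ} (hσ : 0 ≤ σ) (x : A.Scale σ) :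
    Continuous fun t => A.expCLM hσ t x := by
  have h1 := lp.hasSum_single (by norm_num : (2 : ℝ≥0∞) ≠ ⊤) (A.weightedEquiv hσ x)
  rw [HasSum, Metric.tendsto_nhds] at h1
  refine continuous_of_uniform_approx_of_continuous fun u hu => ?_
  rw [Metric.mem_uniformity_dist] at hu
  obtain ⟨η, hη, hu⟩ := hu
  obtain ⟨s, hs⟩ := (h1 (η / 2) (by positivity)).exists
  refine ⟨fun t => A.expCLM hσ t ((A.weightedEquiv hσ).symm
    (∑ ω ∈ s, lp.single 2 ω (A.weightedEquiv hσ x ω))), ?_, fun t => hu ?_⟩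
  · simp only [map_sum]
    refine continuous_finsetSum _ fun ω _ => ?_
    have : ∀ t v, A.expCLM hσ t ((A.weightedEquiv hσ).symm (lp.single 2 ω v)) =
        (A.weightedEquiv hσ).symm (lp.single 2 ω (A.expEig t ω v)) := by
      intro t v
      apply (A.weightedEquiv hσ).injective
      rw [LinearIsometryEquiv.apply_symm_apply]
      ext1
      funext ν
      rw [weightedEquiv_apply, spec_expCLM, ← expEig_smul, ← weightedEquiv_apply A hσ,
        LinearIsometryEquiv.apply_symm_apply]
      by_cases hν : ν = ω
      · subst hν
        rw [lp.single_apply_self, lp.single_apply_self]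
      · rw [lp.single_apply_ne _ _ _ hν, lp.single_apply_ne _ _ _ hν]
        exact (A.expEigₗ t ν).map_zero
    simp only [this]
    exact (A.weightedEquiv hσ).symm.continuous.comp
      ((lp.isometry_single ω).continuous.comp (A.continuous_expEig ω _))
  · rw [dist_eq_norm, ← map_sub]
    refine (A.norm_expCLM_le hσ t _).trans_lt ?_
    rw [← LinearIsometryEquiv.norm_map (A.weightedEquiv hσ), map_sub,
      LinearIsometryEquiv.apply_symm_apply, ← dist_eq_norm, dist_comm]
    linarith

/-- The group `e^{tA}` on `X^σ`. -/
noncomputable def group {σ : ℝ} (hσ : 0 ≤ σ) : OrthogonalGroup (A.Scale σ) where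
  op := A.expCLM hσ
  op_zero := by
    ext x
    refine Scale.ext_spec A fun ω => ?_
    rw [spec_expCLM]
    simp [expEig]
  op_add s t := by
    ext x
    refine Scale.ext_spec A fun ω => ?_
    rw [ContinuousLinearMap.comp_apply, spec_expCLM, spec_expCLM, spec_expCLM, expEig_add]
  norm_le := A.norm_expCLM_le hσ
  continuous_op := A.continuous_expCLM hσ
  inner_op t x y := by
    rw [inner_scale, inner_scale]
    refine tsum_congr fun ω => ?_
    rw [spec_expCLM, spec_expCLM, inner_expEig]

/-! ### Spectral cut-off -/

open Classical in
/-- The spectral projection of `X^σ` onto the frequencies `ω ≤ n`. -/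
noncomputable def lowFreq {σ : ℝ} (hσ : 0 ≤ σ) (n : ℕ) : A.Scale σ →L[ℝ] A.Scale σ :=
  A.diag hσ (fun ω => if (ω : ℝ) ≤ n then LinearMap.id else 0) 1 (by
    intro ω v
    split_ifs <;> simp)

open Classical in
/-- The restriction of `A` to the frequencies `ω ≤ n`. -/
noncomputable def lowFreqOp {σ : ℝ} (hσ : 0 ≤ σ) (n : ℕ) : A.Scale σ →L[ℝ] A.Scale σ :=
  A.diag hσ (fun ω => if (ω : ℝ) ≤ n then A.opEig ω else 0) n (by
    intro ω v
    split_ifs with h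
    · rw [norm_opEig]
      exact mul_le_mul_of_nonneg_right h (norm_nonneg _)
    · simp only [LinearMap.zero_apply, norm_zero]
      positivity)

theorem lowFreq_comm {σ : ℝ} (hσ : 0 ≤ σ) (n : ℕ) (t : ℝ) (x : A.Scale σ) :
    A.lowFreq hσ n (A.expCLM hσ t x) = A.expCLM hσ t (A.lowFreq hσ n x) := by
  refine Scale.ext_spec A fun ω => ?_
  rw [spec_expCLM, lowFreq, spec_diag, spec_diag, spec_expCLM]
  split_ifs
  · rfl
  · exact (A.expEigₗ t ω).map_zero.symm

/-- Second-order Taylor estimate at `t = 0`. Its constant depends on `ω` only through `ω ^ 2`, so it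
is uniform on bounded frequencies. -/
theorem norm_expEig_sub_le (t : ℝ) (ω : ℝ≥0) (v : A.eig ω) :
    ‖A.expEig t ω v - v - t • A.opEig ω v‖ ≤ 2 * (ω * t) ^ 2 * ‖v‖ := by
  have e : A.expEig t ω v - v - t • A.opEig ω v =
      (Real.cos (ω * t) - 1) • v + (Real.sin (ω * t) / ω - t) • A.opEig ω v := by
    rw [expEig]; module
  have h1 : ‖(Real.cos (ω * t) - 1) • v‖ ≤ (ω * t) ^ 2 * ‖v‖ := by
    rw [norm_smul, Real.norm_eq_abs]
    refine mul_le_mul_of_nonneg_right ?_ (norm_nonneg _)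
    rw [abs_le]
    constructor <;>
      nlinarith [Real.one_sub_sq_div_two_le_cos (x := ω * t), Real.cos_le_one (ω * t),
        sq_nonneg ((ω : ℝ) * t)]
  have h2 : ‖(Real.sin (ω * t) / ω - t) • A.opEig ω v‖ ≤ (ω * t) ^ 2 * ‖v‖ := by
    -- At `ω = 0` the quotient `sin (ω t) / ω` takes the default value 0 instead of `t`; this is
    -- harmless because `A` vanishes there.
    rcases eq_or_ne ω 0 with rfl | h
    · rw [opEig_zero, smul_zero, norm_zero]
      positivity
    have h' : (ω : ℝ) ≠ 0 := by exact_mod_cast h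
    rw [norm_smul, norm_opEig, ← mul_assoc, Real.norm_eq_abs]
    refine mul_le_mul_of_nonneg_right ?_ (norm_nonneg _)
    have e2 : |Real.sin (ω * t) / ω - t| * ω = |Real.sin (ω * t) - ω * t| := by
      have e3 := abs_mul (Real.sin (ω * t) / ω - t) (ω : ℝ)
      rw [NNReal.abs_eq] at e3
      rw [← e3]
      congr 1
      field_simp
    rw [e2]
    -- Three ranges: below 1 the cubic lower bound for the sine, between 1 and 2 the sign of the
    -- sine together with `y ≤ y²`, and beyond 2 the inequality `y + 1 ≤ y²`.
    have key : ∀ y : ℝ, 0 ≤ y → y - Real.sin y ≤ y ^ 2 := by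
      intro y hy
      rcases le_total y 1 with hy1 | hy1
      · rcases hy.eq_or_lt with rfl | hy0
        · simp
        have := Real.sin_gt_sub_cube hy0
        nlinarith [mul_nonneg (sq_nonneg y) (sub_nonneg.2 hy1)]
      · rcases le_total y 2 with hy2 | hy2
        · have := Real.sin_nonneg_of_nonneg_of_le_pi hy (by linarith [Real.pi_gt_three])
          nlinarith
        · nlinarith [Real.neg_one_le_sin y]
    have key2 : ∀ y : ℝ, |Real.sin y - y| ≤ y ^ 2 := by
      intro y
      rcases le_total 0 y with hy | hy
      · rw [abs_of_nonpos (by linarith [Real.sin_le hy])]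
        linarith [key y hy]
      · have h3 := key (-y) (by linarith)
        have h4 := Real.sin_le (x := -y) (by linarith)
        rw [Real.sin_neg] at h3 h4
        rw [abs_of_nonneg (by linarith)]
        linarith
    exact key2 _
  rw [e]
  refine (norm_add_le _ _).trans ?_
  linarith

/-- The derivative exists in operator norm, not only strongly, because the Taylor remainder is
uniform over `ω ≤ n`. This makes the low frequencies of any mild solution differentiable. -/
theorem hasDerivAt_exp_lowFreq {σ : ℝ} (hσ : 0 ≤ σ) (n : ℕ) (t : ℝ) :
    HasDerivAt (fun t => (A.expCLM hσ t).comp (A.lowFreq hσ n))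
      ((A.lowFreqOp hσ n).comp (A.expCLM hσ t)) t := by
  have h0 : ∀ h : ℝ, ‖(A.expCLM hσ (t + h)).comp (A.lowFreq hσ n) -
      (A.expCLM hσ t).comp (A.lowFreq hσ n) - h • (A.lowFreqOp hσ n).comp (A.expCLM hσ t)‖ ≤
      4 * n ^ 2 * h ^ 2 := by
    intro h
    refine ContinuousLinearMap.opNorm_le_bound _ (by positivity) fun x => ?_
    have h1 : ‖((A.expCLM hσ (t + h)).comp (A.lowFreq hσ n) -
      (A.expCLM hσ t).comp (A.lowFreq hσ n) - h • (A.lowFreqOp hσ n).comp (A.expCLM hσ t)) x‖ ≤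
      (2 * n ^ 2 * h ^ 2) * ‖A.expCLM hσ t x‖ := by
      refine A.norm_scale_le (by positivity) fun ω => ?_
      simp only [sub_apply, ContinuousLinearMap.comp_apply, smul_apply, map_sub, map_smul, lp.coeFn_sub, Pi.sub_apply,
        lp.coeFn_smul, Pi.smul_apply, spec_expCLM]
      rw [lowFreq, lowFreqOp, spec_diag, spec_diag, spec_expCLM, mul_left_comm]
      refine mul_le_mul_of_nonneg_left ?_ (by positivity)
      split_ifs with hω
      · rw [LinearMap.id_apply, add_comm, expEig_add]
        refine (A.norm_expEig_sub_le h ω _).trans ?_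
        refine mul_le_mul_of_nonneg_right ?_ (norm_nonneg _)
        rw [mul_pow, ← mul_assoc]
        gcongr
      · have h2 : ∀ r, A.expEig r ω 0 = 0 := fun r => (A.expEigₗ r ω).map_zero
        simp only [LinearMap.zero_apply, h2, smul_zero, sub_zero, norm_zero]
        positivity
    refine h1.trans ?_
    have := A.norm_expCLM_le hσ t x
    calc _ ≤ (2 * n ^ 2 * h ^ 2) * (2 * ‖x‖) := by gcongr
      _ = _ := by ring
  refine (hasDerivAt_iff_isLittleO_nhds_zero (𝕜 := ℝ) (F := A.Scale σ →L[ℝ] A.Scale σ)).2 ?_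
  refine Asymptotics.IsBigO.trans_isLittleO (g := fun h : ℝ => h ^ 2) ?_ ?_
  · refine Asymptotics.IsBigO.of_bound (4 * n ^ 2) (Filter.Eventually.of_forall fun h => ?_)
    rw [Real.norm_of_nonneg (sq_nonneg h)]
    exact h0 h
  · simpa using! (Asymptotics.isLittleO_pow_id (𝕜 := ℝ) one_lt_two)

theorem scaleSubmodule_anti {σ τ : ℝ} (h : σ ≤ τ) : A.scaleSubmodule τ ≤ A.scaleSubmodule σ := by
  intro x hx
  refine Memℓp.mono' hx fun ω => ?_
  rw [norm_smul, norm_smul, Real.norm_of_nonneg (by positivity),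
    Real.norm_of_nonneg (by positivity)]
  refine mul_le_mul_of_nonneg_right ?_ (norm_nonneg _)
  exact Real.rpow_le_rpow_of_exponent_le (by nlinarith [sq_nonneg (ω : ℝ)]) (by linarith)

theorem val_incl {σ τ : ℝ} (h : σ ≤ τ) (x : A.Scale τ) : (A.incl h x).val = x.val :=
  Submodule.coe_inclusion (p := A.scaleSubmodule τ) (p' := A.scaleSubmodule σ)
    (A.scaleSubmodule_anti h) x

theorem norm_incl_le {σ τ : ℝ} (h : σ ≤ τ) (x : A.Scale τ) : ‖A.incl h x‖ ≤ 1 * ‖x‖ := by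
  refine A.norm_scale_le zero_le_one fun ω => ?_
  rw [one_mul, val_incl]
  refine mul_le_mul_of_nonneg_right ?_ (norm_nonneg _)
  exact Real.rpow_le_rpow_of_exponent_le (by nlinarith [sq_nonneg (ω : ℝ)]) (by linarith)

/-- The inclusion `X^τ ⊆ X^σ` as a bounded operator. -/
noncomputable def inclCLM {σ τ : ℝ} (h : σ ≤ τ) : A.Scale τ →L[ℝ] A.Scale σ :=
  LinearMap.mkContinuous (A.incl h) 1 (A.norm_incl_le h)

theorem val_inclCLM {σ τ : ℝ} (h : σ ≤ τ) (x : A.Scale τ) : (A.inclCLM h x).val = x.val :=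
  A.val_incl h x

/-- Frequencies above `n` pay the ratio of the two weights, at most `(1 + n²)^{-(τ-σ)/2}`. For `τ >
σ` this tends to 0 and supplies the small factor of the contraction. -/
theorem norm_highFreq_incl_le {σ τ : ℝ} (hσ : 0 ≤ σ) (h : σ ≤ τ) (n : ℕ) (x : A.Scale τ) :
    ‖A.inclCLM h x - A.lowFreq hσ n (A.inclCLM h x)‖ ≤
      (1 + (n : ℝ) ^ 2) ^ (-((τ - σ) / 2)) * ‖x‖ := by
  refine A.norm_scale_le (by positivity) fun ω => ?_
  rw [map_sub, map_sub, lp.coeFn_sub, Pi.sub_apply, lowFreq, spec_diag, val_inclCLM]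
  split_ifs with hω
  · rw [LinearMap.id_apply, sub_self, norm_zero, mul_zero]
    positivity
  · rw [LinearMap.zero_apply, sub_zero, ← mul_assoc]
    refine mul_le_mul_of_nonneg_right ?_ (norm_nonneg _)
    have hpos : (0 : ℝ) < 1 + (ω : ℝ) ^ 2 := by positivity
    have e : σ / 2 = -((τ - σ) / 2) + τ / 2 := by ring
    rw [e, Real.rpow_add hpos]
    refine mul_le_mul_of_nonneg_right ?_ (by positivity)
    refine Real.rpow_le_rpow_of_nonpos (by positivity) ?_ (by linarith)
    have := (not_le.1 hω).le
    gcongr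

theorem exists_norm_highFreq_incl_le {σ τ : ℝ} (hσ : 0 ≤ σ) (h : σ < τ) {η : ℝ} (hη : 0 < η) :
    ∃ n : ℕ, ∀ x : A.Scale τ,
      ‖A.inclCLM h.le x - A.lowFreq hσ n (A.inclCLM h.le x)‖ ≤ η * ‖x‖ := by
  have h1 : Filter.Tendsto (fun n : ℕ => (1 + (n : ℝ) ^ 2) ^ (-((τ - σ) / 2))) Filter.atTop
      (nhds 0) := by
    refine (tendsto_rpow_neg_atTop (by linarith)).comp ?_
    refine Filter.tendsto_atTop_add_const_left _ _ ?_
    exact (Filter.tendsto_pow_atTop two_ne_zero).comp tendsto_natCast_atTop_atTop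
  obtain ⟨n, hn⟩ := (h1.eventually (ge_mem_nhds hη)).exists
  exact ⟨n, fun x => (A.norm_highFreq_incl_le hσ h.le n x).trans
    (mul_le_mul_of_nonneg_right hn (norm_nonneg _))⟩

theorem norm_val_le {σ : ℝ} (hσ : 0 ≤ σ) (x : A.Scale σ) : ‖x.val‖ ≤ 1 * ‖x‖ := by
  rw [one_mul, ← A.spec.norm_map]
  refine lp.norm_mono (y := Scale.weighted x) (by norm_num) fun ω => ?_
  change _ ≤ ‖(1 + (ω : ℝ) ^ 2) ^ (σ / 2) • A.spec x.val ω‖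
  rw [norm_smul, Real.norm_of_nonneg (by positivity)]
  refine le_mul_of_one_le_left (norm_nonneg _) ?_
  exact Real.one_le_rpow (by nlinarith [sq_nonneg (ω : ℝ)]) (by linarith)

/-- The inclusion `X^σ ⊆ X` as a bounded operator. -/
noncomputable def valCLM {σ : ℝ} (hσ : 0 ≤ σ) : A.Scale σ →L[ℝ] X :=
  LinearMap.mkContinuous Scale.val 1 (A.norm_val_le hσ)

end SkewAdjointOp

section

open scoped unitInterval

/-! ### Holomorphic fixed points and holomorphy in spaces of continuous functions. -/

section Holomorphic

open Metric

/-- A contraction depending holomorphically on a parameter has a holomorphic fixed point. -/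
theorem exists_differentiableOn_fixedPoint {E : Type*} [NormedAddCommGroup E] [NormedSpace ℂ E]
    [CompleteSpace E] (Φ : ℂ → E → E) (u₀ : E) {r ρ : ℝ}
    (hlip : ∀ l ∈ ball (0 : ℂ) r, ∀ u ∈ closedBall u₀ ρ, ∀ v ∈ closedBall u₀ ρ,
      ‖Φ l u - Φ l v‖ ≤ 1 / 2 * ‖u - v‖)
    (h0 : ∀ l ∈ ball (0 : ℂ) r, ‖Φ l u₀ - u₀‖ ≤ ρ / 2)
    (hol : ∀ g : ℂ → E, DifferentiableOn ℂ g (ball 0 r) →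
      (∀ l ∈ ball (0 : ℂ) r, g l ∈ closedBall u₀ ρ) →
      DifferentiableOn ℂ (fun l => Φ l (g l)) (ball 0 r)) :
    ∃ g : ℂ → E, DifferentiableOn ℂ g (ball 0 r) ∧
      ∀ l ∈ ball (0 : ℂ) r, ∀ v ∈ closedBall u₀ ρ, Φ l v = v → g l = v := by
  set a : ℕ → ℂ → E := fun k l => (Φ l)^[k] u₀ with ha
  have a0 : ∀ l, a 0 l = u₀ := fun l => rfl
  have asucc : ∀ k l, a (k + 1) l = Φ l (a k l) := fun k l =>
    Function.iterate_succ_apply' _ _ _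
  have hb : ∀ l ∈ ball (0 : ℂ) r, 0 ≤ ρ := fun l hl => by
    linarith [(norm_nonneg _).trans (h0 l hl)]
  have hu₀ : ∀ l ∈ ball (0 : ℂ) r, u₀ ∈ closedBall u₀ ρ := fun l hl =>
    mem_closedBall_self (hb l hl)
  have hmap : ∀ l ∈ ball (0 : ℂ) r, ∀ u ∈ closedBall u₀ ρ, Φ l u ∈ closedBall u₀ ρ := by
    intro l hl u hu
    rw [mem_closedBall, dist_eq_norm]
    have h1 := hlip l hl u hu u₀ (hu₀ l hl)
    have h2 := h0 l hl
    rw [mem_closedBall, dist_eq_norm] at hu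
    calc ‖Φ l u - u₀‖ = ‖(Φ l u - Φ l u₀) + (Φ l u₀ - u₀)‖ := by congr 1; abel
      _ ≤ _ := norm_add_le _ _
      _ ≤ ρ := by linarith
  have hmem : ∀ k, ∀ l ∈ ball (0 : ℂ) r, a k l ∈ closedBall u₀ ρ := by
    intro k l hl
    induction k with
    | zero => exact hu₀ l hl
    | succ k ih => rw [asucc]; exact hmap l hl _ ih
  have hdiff : ∀ k, DifferentiableOn ℂ (a k) (ball 0 r) := by
    intro k
    induction k with
    | zero => exact differentiableOn_const u₀
    | succ k ih =>
      have : a (k + 1) = fun l => Φ l (a k l) := funext (asucc k)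
      rw [this]
      exact hol _ ih (hmem k)
  have hstep : ∀ k, ∀ l ∈ ball (0 : ℂ) r, ‖a (k + 1) l - a k l‖ ≤ (1 / 2) ^ k * (ρ / 2) := by
    intro k l hl
    induction k with
    | zero => rw [asucc, a0, pow_zero, one_mul]; exact h0 l hl
    | succ k ih =>
      rw [asucc (k + 1)]
      nth_rewrite 2 [asucc k]
      refine (hlip l hl _ (hmem _ l hl) _ (hmem _ l hl)).trans ?_
      rw [pow_succ']
      linarith
  have hsum : Summable fun k : ℕ => (1 / 2 : ℝ) ^ k * (ρ / 2) :=
    (summable_geometric_of_lt_one (by norm_num) (by norm_num)).mul_right _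
  -- The limit of the Picard iterates is written as a telescoping series, dominated by a geometric
  -- series uniformly in `l`, so that Weierstrass' theorem gives holomorphy.
  refine ⟨fun l => u₀ + ∑' k, (a (k + 1) l - a k l), ?_, ?_⟩
  · exact (differentiableOn_const u₀).add
      (Complex.differentiableOn_tsum_of_summable_norm hsum
        (fun k => (hdiff (k + 1)).sub (hdiff k)) isOpen_ball hstep)
  · intro l hl v hv hfix
    -- Each iteration halves the distance to any given fixed point in the ball, so the iterates
    -- converge to it.
    have h1 : ∀ k, ‖a k l - v‖ ≤ (1 / 2) ^ k * ‖u₀ - v‖ := by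
      intro k
      induction k with
      | zero => simp [a0]
      | succ k ih =>
        rw [asucc]
        nth_rewrite 1 [← hfix]
        refine (hlip l hl _ (hmem _ l hl) _ hv).trans ?_
        rw [pow_succ']
        linarith
    have h2 : Filter.Tendsto (fun k => a k l) Filter.atTop (nhds v) := by
      rw [tendsto_iff_norm_sub_tendsto_zero]
      refine squeeze_zero (fun _ => norm_nonneg _) h1 ?_
      simpa using (tendsto_pow_atTop_nhds_zero_of_lt_one (by norm_num : (0 : ℝ) ≤ 1 / 2)
        (by norm_num)).mul_const ‖u₀ - v‖
    have h3 : Summable fun k => a (k + 1) l - a k l :=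
      Summable.of_norm_bounded hsum fun k => hstep k l hl
    have h4 := h3.hasSum.tendsto_sum_nat
    simp only [Finset.sum_range_sub (fun k => a k l), a0] at h4
    have h5 := tendsto_nhds_unique h4 (h2.sub_const u₀)
    simp only [h5, add_sub_cancel]

/-- A continuous family of functions on a compact space which is holomorphic in the parameter at
each point is holomorphic for the uniform norm. -/
theorem ContinuousMap.differentiableOn_of_eval {K Y : Type*} [TopologicalSpace K]
    [CompactSpace K] [NormedAddCommGroup Y] [NormedSpace ℂ Y] [CompleteSpace Y]
    {f : ℂ → C(K, Y)} {s : Set ℂ} (hs : IsOpen s) (hf : ContinuousOn f s)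
    (h : ∀ k, DifferentiableOn ℂ (fun z => f z k) s) : DifferentiableOn ℂ f s := by
  intro c hc
  obtain ⟨R, hR, hRs⟩ := Metric.nhds_basis_closedBall.mem_iff.1 (hs.mem_nhds hc)
  lift R to ℝ≥0 using hR.le
  have hR' : 0 < R := by exact_mod_cast hR
  have hint : CircleIntegrable f c R :=
    (hf.mono (sphere_subset_closedBall.trans hRs)).circleIntegrable R.2
  -- The Cauchy integral of `f`, taken in `C(K, Y)`, is analytic for the uniform norm; evaluation at
  -- each `k` commutes with the integral, and the scalar-parameter Cauchy formula there shows that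
  -- it equals `f`.
  have hps := hasFPowerSeriesOn_cauchy_integral hint hR'
  refine (hps.analyticAt.differentiableAt.congr_of_eventuallyEq ?_).differentiableWithinAt
  filter_upwards [ball_mem_nhds c hR] with w hw
  ext k
  have h1 : DiffContOnCl ℂ (fun z => f z k) (ball c R) := by
    refine ((h k).mono ?_).diffContOnCl_ball (U := closedBall c R) subset_rfl
    exact hRs
  have h2 := h1.two_pi_i_inv_smul_circleIntegral_sub_inv_smul hw
  have h3 : CircleIntegrable (fun z => (z - w)⁻¹ • f z) c R := by
    refine ContinuousOn.circleIntegrable R.2 ?_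
    refine ContinuousOn.smul (M := ℂ) ?_ (hf.mono (sphere_subset_closedBall.trans hRs))
    refine ContinuousOn.inv₀ (by fun_prop) fun z hz hzw => ?_
    rw [sub_eq_zero.1 hzw] at hz
    exact (mem_ball.1 hw).ne (mem_sphere.1 hz)
  change f w k = ((2 * Real.pi * Complex.I : ℂ)⁻¹ • ∮ z in C(c, R), (z - w)⁻¹ • f z : C(K, Y)) k
  rw [← h2, ContinuousMap.smul_apply]
  congr 1
  have h4 := (ContinuousMap.evalCLM ℂ k : C(K, Y) →L[ℂ] Y).intervalIntegral_comp_comm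
    h3.out
  exact h4

end Holomorphic

/-! ### Complexification of operators between spaces of continuous functions. -/

namespace Complexified

variable {Y Z : Type*} [NormedAddCommGroup Y] [NormedAddCommGroup Z]

theorem norm_re_le (y : Complexified Y) : ‖y.re‖ ≤ ‖y‖ := by
  refine le_of_sq_le_sq ?_ (norm_nonneg _)
  rw [norm_sq_eq]
  linarith [sq_nonneg ‖y.im‖]

theorem norm_im_le (y : Complexified Y) : ‖y.im‖ ≤ ‖y‖ := by
  refine le_of_sq_le_sq ?_ (norm_nonneg _)
  rw [norm_sq_eq]
  linarith [sq_nonneg ‖y.re‖]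

theorem norm_le_re_add_im (y : Complexified Y) : ‖y‖ ≤ ‖y.re‖ + ‖y.im‖ := by
  refine le_of_sq_le_sq ?_ (by positivity)
  rw [norm_sq_eq]
  nlinarith [mul_nonneg (norm_nonneg y.re) (norm_nonneg y.im)]

theorem norm_ofReal (y : Y) : ‖ofReal y‖ = ‖y‖ := by
  have h := norm_sq_eq (ofReal y)
  have h2 : ‖(ofReal y).im‖ = 0 := norm_zero
  rw [h2, zero_pow two_ne_zero, add_zero] at h
  exact (sq_eq_sq₀ (norm_nonneg _) (norm_nonneg _)).1 h

theorem ofReal_add (x y : Y) : ofReal (x + y) = ofReal x + ofReal y :=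
  ext rfl (add_zero (0 : Y)).symm

theorem continuous_mk : Continuous fun p : Y × Y => mk p.1 p.2 :=
  WithLp.prod_continuous_toLp 2 Y Y

variable [InnerProductSpace ℝ Y] [InnerProductSpace ℝ Z]

theorem re_real_smul (c : ℝ) (y : Complexified Y) : (c • y).re = c • y.re := by
  change ((c : ℂ) • y).re = _
  rw [re_smul, Complex.ofReal_re, Complex.ofReal_im, zero_smul, sub_zero]

theorem im_real_smul (c : ℝ) (y : Complexified Y) : (c • y).im = c • y.im := by
  change ((c : ℂ) • y).im = _
  rw [im_smul, Complex.ofReal_re, Complex.ofReal_im, zero_smul, add_zero]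

instance [CompleteSpace Y] : CompleteSpace (Complexified Y) :=
  inferInstanceAs (CompleteSpace (WithLp 2 (Y × Y)))

/-- The real part as a bounded operator. -/
noncomputable def reCLM : Complexified Y →L[ℝ] Y :=
  LinearMap.mkContinuous
    { toFun := re
      map_add' := re_add
      map_smul' := re_real_smul } 1 (fun y => by rw [one_mul]; exact norm_re_le y)

/-- The imaginary part as a bounded operator. -/
noncomputable def imCLM : Complexified Y →L[ℝ] Y :=
  LinearMap.mkContinuous
    { toFun := im
      map_add' := im_add
      map_smul' := im_real_smul } 1 (fun y => by rw [one_mul]; exact norm_im_le y)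

theorem ofReal_real_smul (c : ℝ) (y : Y) : ofReal (c • y) = (c : ℂ) • ofReal y := by
  refine ext ?_ ?_
  · rw [re_smul]
    simp [ofReal, mk, re, im]
  · rw [im_smul]
    simp [ofReal, mk, re, im]

/-- The inclusion `Y ⊆ Y_ℂ` as a bounded operator. -/
noncomputable def ofRealCLM : Y →L[ℝ] Complexified Y :=
  LinearMap.mkContinuous
    { toFun := ofReal
      map_add' := ofReal_add
      map_smul' := ofReal_real_smul } 1 (fun y => by rw [one_mul]; exact (norm_ofReal y).le)

theorem continuous_re : Continuous (re : Complexified Y → Y) := reCLM.continuous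

theorem continuous_im : Continuous (im : Complexified Y → Y) := imCLM.continuous

theorem continuous_ofReal : Continuous (ofReal : Y → Complexified Y) := ofRealCLM.continuous

variable {K : Type*} [TopologicalSpace K] [CompactSpace K]

/-- The real part of a continuous function. -/
noncomputable def mapRe (u : C(K, Complexified Y)) : C(K, Y) := ⟨fun k => (u k).re,
  continuous_re.comp u.continuous⟩

/-- The imaginary part of a continuous function. -/
noncomputable def mapIm (u : C(K, Complexified Y)) : C(K, Y) := ⟨fun k => (u k).im,
  continuous_im.comp u.continuous⟩

/-- A continuous function with values in `Y`, seen with values in `Y_ℂ`. -/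
noncomputable def mapOfReal (u : C(K, Y)) : C(K, Complexified Y) := ⟨fun k => ofReal (u k),
  continuous_ofReal.comp u.continuous⟩

theorem norm_mapRe_le (u : C(K, Complexified Y)) : ‖mapRe u‖ ≤ ‖u‖ :=
  (ContinuousMap.norm_le _ (norm_nonneg _)).2 fun k =>
    (norm_re_le _).trans (u.norm_coe_le_norm k)

theorem norm_mapIm_le (u : C(K, Complexified Y)) : ‖mapIm u‖ ≤ ‖u‖ :=
  (ContinuousMap.norm_le _ (norm_nonneg _)).2 fun k =>
    (norm_im_le _).trans (u.norm_coe_le_norm k)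

/-- The complexification of a bounded operator between spaces of continuous functions. -/
noncomputable def mapCLM (b : C(K, Y) →L[ℝ] C(K, Z)) :
    C(K, Complexified Y) →L[ℂ] C(K, Complexified Z) :=
  LinearMap.mkContinuous
    { toFun := fun u => ⟨fun k => mk (b (mapRe u) k) (b (mapIm u) k),
        continuous_mk.comp ((b (mapRe u)).continuous.prodMk (b (mapIm u)).continuous)⟩
      map_add' := by
        intro u v
        have h1 : mapRe (u + v) = mapRe u + mapRe v := rfl
        have h2 : mapIm (u + v) = mapIm u + mapIm v := rfl
        ext k
        refine Complexified.ext ?_ ?_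
        · change b (mapRe (u + v)) k = b (mapRe u) k + b (mapRe v) k
          rw [h1, map_add, ContinuousMap.add_apply]
        · change b (mapIm (u + v)) k = b (mapIm u) k + b (mapIm v) k
          rw [h2, map_add, ContinuousMap.add_apply]
      map_smul' := by
        intro c u
        have h1 : mapRe (c • u) = c.re • mapRe u - c.im • mapIm u := rfl
        have h2 : mapIm (c • u) = c.re • mapIm u + c.im • mapRe u := rfl
        ext k
        refine Complexified.ext ?_ ?_
        · change b (mapRe (c • u)) k = c.re • b (mapRe u) k - c.im • b (mapIm u) k
          rw [h1, map_sub, map_smul, map_smul]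
          rfl
        · change b (mapIm (c • u)) k = c.re • b (mapIm u) k + c.im • b (mapRe u) k
          rw [h2, map_add, map_smul, map_smul]
          rfl } (2 * ‖b‖) (by
    intro u
    refine (ContinuousMap.norm_le _ (by positivity)).2 fun k => ?_
    refine (norm_le_re_add_im _).trans ?_
    change ‖b (mapRe u) k‖ + ‖b (mapIm u) k‖ ≤ _
    have h1 := ((b (mapRe u)).norm_coe_le_norm k).trans (b.le_opNorm _)
    have h2 := ((b (mapIm u)).norm_coe_le_norm k).trans (b.le_opNorm _)
    have h3 := mul_le_mul_of_nonneg_left (norm_mapRe_le u) (norm_nonneg b)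
    have h4 := mul_le_mul_of_nonneg_left (norm_mapIm_le u) (norm_nonneg b)
    linarith)

/-- The factor 2 comes from bounding the real and imaginary parts separately; it is absorbed later
in the choice of the frequency cut-off. -/
theorem norm_mapCLM_le (b : C(K, Y) →L[ℝ] C(K, Z)) (u : C(K, Complexified Y)) :
    ‖mapCLM b u‖ ≤ 2 * ‖b‖ * ‖u‖ :=
  (mapCLM b).le_of_opNorm_le (LinearMap.mkContinuous_norm_le _ (by positivity) _) u

theorem mapCLM_mapOfReal (b : C(K, Y) →L[ℝ] C(K, Z)) (u : C(K, Y)) :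
    mapCLM b (mapOfReal u) = mapOfReal (b u) := by
  have h1 : mapIm (mapOfReal u) = 0 := rfl
  ext k
  refine Complexified.ext rfl ?_
  change b (mapIm (mapOfReal u)) k = 0
  rw [h1, map_zero, ContinuousMap.zero_apply]

end Complexified

/-! ### Integration, multiplication and group operators on continuous functions. -/

section Operators

variable {H : Type*} [NormedAddCommGroup H] [InnerProductSpace ℝ H]
  {K : Type*} [TopologicalSpace K] [CompactSpace K]

/-- The operator `u ↦ (k ↦ m(k) ∫₀¹ u(φ(k, ρ)) dρ)`. -/
noncomputable def intOp [FirstCountableTopology K] [LocallyCompactSpace K] (φ : C(K × I, K)) (m : ℝ) : C(K, H) →L[ℝ] C(K, H) :=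
  have hc : ∀ u : C(K, H), Continuous (Function.uncurry fun k ρ => u (φ (k, ρ))) := fun u => by
    exact u.continuous.comp φ.continuous
  have hi : ∀ (u : C(K, H)) k, MeasureTheory.Integrable fun ρ : I => u (φ (k, ρ)) := fun u k =>
    Continuous.integrable_of_hasCompactSupport (u.continuous.comp
      (φ.continuous.comp (Continuous.prodMk_right k)))
      (HasCompactSupport.of_compactSpace _)
  LinearMap.mkContinuous
    { toFun := fun u => ⟨fun k => m • ∫ ρ : I, u (φ (k, ρ)),
        (by
          have := continuous_parametric_integral_of_continuous
            (μ := (MeasureTheory.volume : MeasureTheory.Measure I)) (hc u)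
            (s := Set.univ) isCompact_univ
          simp only [MeasureTheory.Measure.restrict_univ] at this
          exact this.const_smul m)⟩
      map_add' := by
        intro u v
        ext k
        simp only [ContinuousMap.coe_mk, ContinuousMap.add_apply]
        rw [MeasureTheory.integral_add (hi u k) (hi v k), smul_add]
      map_smul' := by
        intro c u
        ext k
        simp only [ContinuousMap.coe_mk, ContinuousMap.smul_apply, RingHom.id_apply]
        rw [MeasureTheory.integral_smul, smul_comm] } |m| (by
    intro u
    refine (ContinuousMap.norm_le _ (by positivity)).2 fun k => ?_
    change ‖m • ∫ ρ : I, u (φ (k, ρ))‖ ≤ _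
    rw [norm_smul, Real.norm_eq_abs]
    refine mul_le_mul_of_nonneg_left ?_ (abs_nonneg m)
    refine (MeasureTheory.norm_integral_le_of_norm_le_const (C := ‖u‖)
      (Filter.Eventually.of_forall fun ρ => u.norm_coe_le_norm _)).trans ?_
    simp)

theorem intOp_apply [FirstCountableTopology K] [LocallyCompactSpace K] (φ : C(K × I, K)) (m : ℝ) (u : C(K, H)) (k : K) :
    intOp φ m u k = m • ∫ ρ : I, u (φ (k, ρ)) := rfl

/-- Multiplication by a continuous real function. -/
noncomputable def mulOp (m : C(K, ℝ)) : C(K, H) →L[ℝ] C(K, H) :=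
  LinearMap.mkContinuous
    { toFun := fun u => ⟨fun k => m k • u k, by fun_prop⟩
      map_add' := fun u v => by ext k; exact smul_add _ _ _
      map_smul' := fun c u => by ext k; exact smul_comm _ _ _ } ‖m‖ (by
    intro u
    refine (ContinuousMap.norm_le _ (by positivity)).2 fun k => ?_
    change ‖m k • u k‖ ≤ _
    rw [norm_smul]
    exact mul_le_mul (m.norm_coe_le_norm k) (u.norm_coe_le_norm k) (norm_nonneg _)
      (norm_nonneg _))

theorem mulOp_apply (m : C(K, ℝ)) (u : C(K, H)) (k : K) : mulOp m u k = m k • u k := rfl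

namespace OrthogonalGroup

variable (e : OrthogonalGroup H)

/-- Joint continuity follows from strong continuity and the uniform bound by splitting off `e.op p.1
(p.2 - x)`. -/
theorem continuous_uncurry : Continuous fun p : ℝ × H => e.op p.1 p.2 := by
  rw [continuous_iff_continuousAt]
  rintro ⟨t, x⟩
  rw [ContinuousAt, tendsto_iff_norm_sub_tendsto_zero]
  have h1 : Filter.Tendsto (fun p : ℝ × H => 2 * ‖p.2 - x‖ + ‖e.op p.1 x - e.op t x‖)
      (nhds (t, x)) (nhds 0) := by
    have : Continuous fun p : ℝ × H => 2 * ‖p.2 - x‖ + ‖e.op p.1 x - e.op t x‖ := by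
      have := e.continuous_op x
      fun_prop
    have := this.tendsto (t, x)
    simpa using this
  refine squeeze_zero (fun _ => norm_nonneg _) (fun p => ?_) h1
  calc ‖e.op p.1 p.2 - e.op t x‖ = ‖e.op p.1 (p.2 - x) + (e.op p.1 x - e.op t x)‖ := by
        rw [map_sub]; congr 1; abel
    _ ≤ _ := norm_add_le _ _
    _ ≤ _ := by gcongr; exact e.norm_le _ _

theorem _root_.Continuous.orthogonalGroup_op {α : Type*} [TopologicalSpace α] {f : α → ℝ}
    {g : α → H} (hf : Continuous f) (hg : Continuous g) :
    Continuous fun a => e.op (f a) (g a) :=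
  e.continuous_uncurry.comp (hf.prodMk hg)

theorem op_op_neg (t : ℝ) (x : H) : e.op t (e.op (-t) x) = x := by
  rw [← ContinuousLinearMap.comp_apply, ← e.op_add, add_neg_cancel, e.op_zero]
  rfl

theorem op_op (s t : ℝ) (x : H) : e.op s (e.op t x) = e.op (s + t) x := by
  rw [e.op_add]; rfl

/-- The operator `u ↦ (k ↦ e^{τ(k)} u(k))`. -/
noncomputable def mapOp (τ : C(K, ℝ)) : C(K, H) →L[ℝ] C(K, H) :=
  LinearMap.mkContinuous
    { toFun := fun u => ⟨fun k => e.op (τ k) (u k),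
        Continuous.orthogonalGroup_op e τ.continuous u.continuous⟩
      map_add' := fun u v => by ext k; exact map_add (e.op (τ k)) (u k) (v k)
      map_smul' := fun c u => by ext k; exact map_smul (e.op (τ k)) c (u k) } 2 (by
    intro u
    refine (ContinuousMap.norm_le _ (by positivity)).2 fun k => ?_
    refine (e.norm_le _ _).trans ?_
    exact mul_le_mul_of_nonneg_left (u.norm_coe_le_norm k) zero_le_two)

end OrthogonalGroup

end Operators

end

section

open scoped unitInterval

/-- Integrals normalized to the unit interval obey one formula for every real `c`, zero and negative
values included; shifts `l` of both signs are needed. -/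
theorem smul_integral_unitInterval {E : Type*} [NormedAddCommGroup E] [NormedSpace ℝ E]
    (f : ℝ → E) (c : ℝ) : c • ∫ ρ : I, f (c * ρ) = ∫ x in (0 : ℝ)..c, f x := by
  have h1 : ∫ ρ : I, f (c * ρ) = ∫ x in (0 : ℝ)..1, f (c * x) := by
    rw [intervalIntegral.integral_of_le zero_le_one, ← MeasureTheory.integral_Icc_eq_integral_Ioc]
    exact MeasureTheory.integral_subtype_comap (μ := MeasureTheory.volume) measurableSet_Icc
      (fun x => f (c * x))
  rw [h1, intervalIntegral.smul_integral_comp_mul_left, mul_zero, mul_one]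

/-! ### The Duhamel operator and the reconstruction from observations. -/

section Operators

variable {H : Type*} [NormedAddCommGroup H] [InnerProductSpace ℝ H]

/-- The function `(s, θ) ↦ c θ` on the square. -/
noncomputable def scaledSnd (c : ℝ) : C(I × I, ℝ) := ⟨fun k => c * k.2, by fun_prop⟩

/-- The operator `u ↦ ((s, θ) ↦ ∫₀ˢ u(r, θ) dr)`. -/
noncomputable def primFst : C(I × I, H) →L[ℝ] C(I × I, H) :=
  (mulOp ⟨fun k => (k.1 : ℝ), by fun_prop⟩).comp
    (intOp ⟨fun p : (I × I) × I => (p.1.1 * p.2, p.1.2), by fun_prop⟩ 1)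

/-- The operator `u ↦ ((s, θ) ↦ T ∫₀¹ u(s, ρ) dρ)`. -/
noncomputable def totalSnd (T : ℝ) : C(I × I, H) →L[ℝ] C(I × I, H) :=
  intOp ⟨fun p : (I × I) × I => (p.1.1, p.2), by fun_prop⟩ T

/-- The Duhamel operator `u ↦ ((s, θ) ↦ ∫₀^{Tθ} e^{Tθ - τ} u(s, τ / T) dτ)`. -/
noncomputable def OrthogonalGroup.duhamel (e : OrthogonalGroup H) (T : ℝ) :
    C(I × I, H) →L[ℝ] C(I × I, H) :=
  ((e.mapOp (scaledSnd T)).comp (mulOp (scaledSnd 1))).comp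
    ((intOp ⟨fun p : (I × I) × I => (p.1.1, p.1.2 * p.2), by fun_prop⟩ T).comp
      (e.mapOp (scaledSnd (-T))))

theorem primFst_apply (u : C(I × I, H)) (k : I × I) :
    primFst u k = (k.1 : ℝ) • ∫ ρ : I, u (k.1 * ρ, k.2) := by
  rw [primFst, ContinuousLinearMap.comp_apply, mulOp_apply, intOp_apply, one_smul]
  rfl

theorem OrthogonalGroup.duhamel_apply (e : OrthogonalGroup H) (T : ℝ) (u : C(I × I, H))
    (k : I × I) : e.duhamel T u k =
      e.op (T * k.2) ((T * k.2) • ∫ ρ : I, e.op (-(T * k.2 * ρ)) (u (k.1, k.2 * ρ))) := by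
  have h : e.duhamel T u k = e.op (T * k.2) ((1 * (k.2 : ℝ)) • T • ∫ ρ : I,
      e.op (-T * ((k.2 * ρ : I) : ℝ)) (u (k.1, k.2 * ρ))) := rfl
  rw [h, smul_smul, one_mul, mul_comm (k.2 : ℝ) T]
  refine congrArg (fun y : H => e.op (T * k.2) ((T * k.2 : ℝ) • y)) ?_
  refine MeasureTheory.integral_congr_ae (Filter.Eventually.of_forall fun ρ => ?_)
  change e.op (-T * ((k.2 * ρ : I) : ℝ)) _ = _
  congr 2
  rw [Set.Icc.coe_mul]
  ring

/-- A coercive operator has a bounded left inverse (Lax-Milgram). -/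
theorem exists_leftInverse_of_coercive [CompleteSpace H] (N : H →L[ℝ] H) {c : ℝ} (hc : 0 < c)
    (h : ∀ x, c * ‖x‖ ^ 2 ≤ inner ℝ (N x) x) : ∃ N' : H →L[ℝ] H, ∀ x, N' (N x) = x := by
  have hB : IsCoercive ((innerSL ℝ).comp N) := ⟨c, hc, fun x => by
    rw [mul_assoc, ← sq]
    exact h x⟩
  refine ⟨hB.continuousLinearEquivOfBilin.symm, fun x => ?_⟩
  have : hB.continuousLinearEquivOfBilin x = N x := by
    refine ext_inner_right ℝ fun y => ?_
    exact hB.continuousLinearEquivOfBilin_apply x y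
  rw [← this]
  exact hB.continuousLinearEquivOfBilin.symm_apply_apply x

/-- Reconstruction of a free solution from its observation on `[0, T]`. -/
theorem OrthogonalGroup.exists_reconstruction [CompleteSpace H] (e : OrthogonalGroup H)
    (C : H →L[ℝ] H) {T K : ℝ} (hK : 0 < K)
    (hobs : ∀ W : H, ‖W‖ ^ 2 ≤ K ^ 2 * ∫ t in (0 : ℝ)..T, ‖C (e.op t W)‖ ^ 2) :
    ∃ R : C(I × I, H) →L[ℝ] C(I × I, H), ∀ v : C(I × I, H),
      (∀ k : I × I, v k = v (k.1, 0)) →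
      R (C.compLeftContinuous ℝ (I × I) (e.mapOp (scaledSnd T) v)) =
        e.mapOp (scaledSnd T) v := by
  -- `G` is the adjoint of the observation map `W ↦ C e^{tA} W`, applied for each `s` separately: it
  -- sends `u` to `∫₀ᵀ e^{-tA} C* u dt`.
  set G : C(I × I, H) →L[ℝ] C(I × I, H) := ((totalSnd T).comp (e.mapOp (scaledSnd (-T)))).comp
    ((ContinuousLinearMap.adjoint C).compLeftContinuous ℝ (I × I)) with hG
  have G_apply : ∀ u k, G u k =
      T • ∫ ρ : I, e.op (-(T * ρ)) (ContinuousLinearMap.adjoint C (u (k.1, ρ))) := by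
    intro u k
    have h : G u k = T • ∫ ρ : I, e.op (-T * (ρ : ℝ))
      (ContinuousLinearMap.adjoint C (u (k.1, ρ))) := rfl
    simp only [h, neg_mul]
  -- `N` is the observability Gramian `∫₀ᵀ e^{-tA} C* C e^{tA} dt`.
  set N : H →L[ℝ] H := ((ContinuousMap.evalCLM ℝ ((0, 0) : I × I)).comp G).comp
    (((C.compLeftContinuous ℝ (I × I)).comp (e.mapOp (scaledSnd T))).comp
      (ContinuousLinearMap.const ℝ (I × I))) with hN
  have N_apply : ∀ x, N x =
      T • ∫ ρ : I, e.op (-(T * ρ)) (ContinuousLinearMap.adjoint C (C (e.op (T * ρ) x))) := by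
    intro x
    have h : N x = G (C.compLeftContinuous ℝ (I × I) (e.mapOp (scaledSnd T)
      (ContinuousMap.const _ x))) (0, 0) := rfl
    rw [h, G_apply]
    rfl
  have hcont : ∀ x, Continuous fun t : ℝ =>
      e.op (-t) (ContinuousLinearMap.adjoint C (C (e.op t x))) := fun x =>
    Continuous.orthogonalGroup_op e continuous_neg (by
      have := e.continuous_op x
      fun_prop)
  -- Since the adjoint of `e^{tA}` is `e^{-tA}`, `⟨N x, x⟩` is the integral of `‖C e^{tA} x‖²`;
  -- observability is exactly coercivity with constant `K⁻²`.
  obtain ⟨N', hN'⟩ := exists_leftInverse_of_coercive N (c := (K ^ 2)⁻¹) (by positivity) (by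
    intro x
    rw [N_apply, smul_integral_unitInterval
      (fun t => e.op (-t) (ContinuousLinearMap.adjoint C (C (e.op t x)))), real_inner_comm,
      ← innerSL_apply_apply ℝ x,
      ← (innerSL ℝ x).intervalIntegral_comp_comm ((hcont x).intervalIntegrable _ _)]
    have h1 : ∀ t, innerSL ℝ x (e.op (-t) (ContinuousLinearMap.adjoint C (C (e.op t x)))) =
        ‖C (e.op t x)‖ ^ 2 := by
      intro t
      rw [innerSL_apply_apply, ← e.inner_op, ContinuousLinearMap.adjoint_inner_right, real_inner_self_eq_norm_sq]
    simp only [h1]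
    rw [inv_mul_le_iff₀ (by positivity)]
    exact hobs x)
  refine ⟨(e.mapOp (scaledSnd T)).comp ((N'.compLeftContinuous ℝ (I × I)).comp G), ?_⟩
  intro v hv
  ext k
  change e.op (T * k.2) (N' (G _ k)) = e.op (T * k.2) (v k)
  have h1 : G (C.compLeftContinuous ℝ (I × I) (e.mapOp (scaledSnd T) v)) k = N (v k) := by
    rw [G_apply, N_apply]
    congr 2
    funext ρ
    rw [hv k, ← hv (k.1, ρ)]
    rfl
  rw [h1, hN']

end Operators

/-! ### Mild solutions. -/

section MildSolution

variable {H : Type*} [NormedAddCommGroup H] [InnerProductSpace ℝ H] [CompleteSpace H]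

/-- The mild solution of `V' = A V + g`, `V(0) = x`. -/
noncomputable def OrthogonalGroup.mild (e : OrthogonalGroup H) (x : H) (g : ℝ → H) (t : ℝ) : H :=
  e.op t (x + ∫ r in (0 : ℝ)..t, e.op (-r) (g r))

namespace OrthogonalGroup

variable (e : OrthogonalGroup H) (x : H) {g : ℝ → H}

/-- Variation of constants: once `e^{tA}` is factored out, what remains is a primitive of a
continuous function, hence differentiable. -/
theorem hasDerivAt_mild_aux (hg : Continuous g) (t : ℝ) :
    HasDerivAt (fun t => x + ∫ r in (0 : ℝ)..t, e.op (-r) (g r)) (e.op (-t) (g t)) t := by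
  have hc : Continuous fun r => e.op (-r) (g r) := Continuous.orthogonalGroup_op e continuous_neg hg
  exact (intervalIntegral.integral_hasDerivAt_right (hc.intervalIntegrable _ _)
    hc.aestronglyMeasurable.stronglyMeasurableAtFilter hc.continuousAt).const_add x

theorem continuous_mild (hg : Continuous g) : Continuous (e.mild x g) :=
  Continuous.orthogonalGroup_op e continuous_id
    (continuous_iff_continuousAt.2 fun t => (e.hasDerivAt_mild_aux x hg t).continuousAt)

/-- Duhamel's formula restarted at time `z`; it exhibits the dependence on the position in the
window once the starting time is fixed. -/
theorem mild_add (hg : Continuous g) (z τ : ℝ) :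
    e.mild x g (z + τ) = e.op τ (e.mild x g z + ∫ r in (0 : ℝ)..τ, e.op (-r) (g (z + r))) := by
  have hc : Continuous fun r => e.op (-r) (g r) := Continuous.orthogonalGroup_op e continuous_neg hg
  rw [mild, mild, add_comm z τ, ← e.op_op]
  congr 1
  rw [map_add, map_add, add_assoc]
  congr 1
  have h1 := intervalIntegral.integral_add_adjacent_intervals (hc.intervalIntegrable 0 z)
    (hc.intervalIntegrable (μ := MeasureTheory.volume) z (τ + z))
  rw [← h1, map_add]
  congr 1
  rw [← ContinuousLinearMap.intervalIntegral_comp_comm _ (hc.intervalIntegrable _ _)]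
  have h2 := intervalIntegral.integral_comp_add_right (a := 0) (b := τ)
    (fun r => e.op z (e.op (-r) (g r))) z
  rw [zero_add] at h2
  rw [← h2]
  refine intervalIntegral.integral_congr fun r _ => ?_
  simp only [e.op_op]
  rw [add_comm r z]
  congr 2
  ring

/-- A mild solution need not be differentiable in `H`, but its low frequencies are: `e^{tA} P` is
differentiable in operator norm, and the product rule applies to the factorization defining `mild`.
-/
theorem hasDerivAt_proj_mild (hg : Continuous g) {P B : H →L[ℝ] H} (hP : ∀ t x, P (e.op t x) = e.op t (P x))
    (hB : ∀ t, HasDerivAt (fun t => (e.op t).comp P) (B.comp (e.op t)) t) (t : ℝ) :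
    HasDerivAt (fun t => P (e.mild x g t)) (B (e.mild x g t) + P (g t)) t := by
  have h1 := (hB t).clm_apply (e.hasDerivAt_mild_aux x hg t)
  simp only [ContinuousLinearMap.comp_apply, ← hP, e.op_op_neg] at h1
  exact h1

end OrthogonalGroup

end MildSolution

/-! ### Translates of a function over the observation window. -/

section Window

/-- The function `(s, θ) ↦ f(z + l s + T θ)` on the square, depending on `l ∈ ℂ`. -/
noncomputable def window {Y : Type*} [TopologicalSpace Y] (f : C(ℂ, Y)) (z T : ℝ) :
    C(ℂ, C(I × I, Y)) :=
  (ContinuousMap.mk (fun p : ℂ × (I × I) =>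
    f ((z : ℂ) + p.1 * ((p.2.1 : ℝ) : ℂ) + (T : ℂ) * ((p.2.2 : ℝ) : ℂ)))
      (f.continuous.comp (by fun_prop))).curry

theorem window_apply {Y : Type*} [TopologicalSpace Y] (f : C(ℂ, Y)) (z T : ℝ) (l : ℂ)
    (k : I × I) : window f z T l k =
      f ((z : ℂ) + l * ((k.1 : ℝ) : ℂ) + (T : ℂ) * ((k.2 : ℝ) : ℂ)) := rfl

/-- A function of a real variable, seen as a function of the real part. -/
noncomputable def realExt {Y : Type*} [TopologicalSpace Y] (f : ℝ → Y) (hf : Continuous f) :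
    C(ℂ, Y) := ⟨fun w => f w.re, hf.comp Complex.continuous_re⟩

theorem window_realExt {Y : Type*} [TopologicalSpace Y] (f : ℝ → Y) (hf : Continuous f)
    (z T l : ℝ) (k : I × I) :
    window (realExt f hf) z T (l : ℂ) k = f (z + l * k.1 + T * k.2) := by
  rw [window_apply]
  change f (Complex.re _) = _
  simp

variable {H : Type*} [NormedAddCommGroup H] [InnerProductSpace ℝ H] [CompleteSpace H]

/-- The fixed point equation for the time translates of a mild solution `V` with `C V = 0`: its low
frequencies solve a differential equation with respect to the translation, its high frequencies are
reconstructed from the observation. -/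
theorem OrthogonalGroup.window_mild_eq (e : OrthogonalGroup H) (x : H) {g : ℝ → H}
    (hg : Continuous g) {P B : H →L[ℝ] H} (hP : ∀ t x, P (e.op t x) = e.op t (P x))
    (hB : ∀ t, HasDerivAt (fun t => (e.op t).comp P) (B.comp (e.op t)) t)
    (C : H →L[ℝ] H) {T : ℝ} (R : C(I × I, H) →L[ℝ] C(I × I, H))
    (hR : ∀ v : C(I × I, H), (∀ k : I × I, v k = v (k.1, 0)) →
      R (C.compLeftContinuous ℝ (I × I) (e.mapOp (scaledSnd T) v)) = e.mapOp (scaledSnd T) v)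
    (z l : ℝ) (v γ a : C(I × I, H))
    (hv : v = window (realExt _ (e.continuous_mild x hg)) z T (l : ℂ))
    (hγ : γ = window (realExt _ hg) z T (l : ℂ))
    (ha : a = P.compLeftContinuous ℝ (I × I)
      (window (realExt _ (e.continuous_mild x hg)) z T ((0 : ℝ) : ℂ)))
    (hC : ∀ k, C (v k) = 0) :
    (ContinuousLinearMap.id ℝ C(I × I, H) - R.comp (C.compLeftContinuous ℝ (I × I)))
      (a + l • primFst (B.compLeftContinuous ℝ (I × I) v + P.compLeftContinuous ℝ (I × I) γ)
        + e.duhamel T ((ContinuousLinearMap.id ℝ H - P).compLeftContinuous ℝ (I × I) γ)) = v := by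
  set V := e.mild x g with hV
  have hVc : Continuous V := e.continuous_mild x hg
  have v_apply : ∀ k, v k = V (z + l * k.1 + T * k.2) := fun k => by
    rw [hv, window_realExt]
  have γ_apply : ∀ k, γ k = g (z + l * k.1 + T * k.2) := fun k => by
    rw [hγ, window_realExt]
  have a_apply : ∀ k, a k = P (V (z + T * k.2)) := fun k => by
    rw [ha]
    change P (window _ z T ((0 : ℝ) : ℂ) k) = _
    rw [window_realExt, zero_mul, add_zero]
  -- Fundamental theorem of calculus along the shift, from `0` to `l s`, at fixed `θ`.
  have hp : a + l • primFst (B.compLeftContinuous ℝ (I × I) v +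
      P.compLeftContinuous ℝ (I × I) γ) = P.compLeftContinuous ℝ (I × I) v := by
    ext k
    rw [ContinuousMap.add_apply, ContinuousMap.smul_apply, primFst_apply, a_apply]
    change _ + l • (k.1 : ℝ) • ∫ ρ : I, (B (v (k.1 * ρ, k.2)) + P (γ (k.1 * ρ, k.2))) = P (v k)
    have hd : ∀ t, HasDerivAt (fun t => P (V (z + T * k.2 + t)))
        (B (V (z + T * k.2 + t)) + P (g (z + T * k.2 + t))) t := fun t =>
      (e.hasDerivAt_proj_mild x hg hP hB _).comp_const_add _ _
    have h1 := intervalIntegral.integral_eq_sub_of_hasDerivAt (a := 0) (b := l * k.1)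
      (fun t _ => hd t) (Continuous.intervalIntegrable (by fun_prop) _ _)
    rw [← smul_integral_unitInterval
      (fun t => B (V (z + T * k.2 + t)) + P (g (z + T * k.2 + t)))] at h1
    have h2 : ∀ ρ : I, B (v (k.1 * ρ, k.2)) + P (γ (k.1 * ρ, k.2)) =
        B (V (z + T * k.2 + l * k.1 * ρ)) + P (g (z + T * k.2 + l * k.1 * ρ)) := by
      intro ρ
      rw [v_apply, γ_apply]
      have : z + l * ((k.1 * ρ : I) : ℝ) + T * k.2 = z + T * k.2 + l * k.1 * ρ := by
        rw [Set.Icc.coe_mul]; ring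
      simp only [this]
    simp only [h2]
    rw [smul_smul, h1, add_zero, add_sub_cancel, v_apply]
    congr 2
    ring
  -- High frequencies at the start `θ = 0` of the shifted window. The function `w` does not depend
  -- on `θ`, so its image under the group is a free solution to which `R` applies.
  set w : C(I × I, H) := ⟨fun k => V (z + l * k.1) - P (V (z + l * k.1)), by fun_prop⟩ with hw
  have hq : e.duhamel T ((ContinuousLinearMap.id ℝ H - P).compLeftContinuous ℝ (I × I) γ) =
      v - P.compLeftContinuous ℝ (I × I) v - e.mapOp (scaledSnd T) w := by
    ext k
    rw [OrthogonalGroup.duhamel_apply]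
    change e.op (T * k.2) ((T * k.2 : ℝ) • ∫ ρ : I, e.op (-(T * k.2 * ρ))
      (γ (k.1, k.2 * ρ) - P (γ (k.1, k.2 * ρ)))) = v k - P (v k) - e.op (T * k.2) (w k)
    set y := V (z + l * k.1) with hy
    set i := ∫ r in (0 : ℝ)..(T * k.2), e.op (-r) (g (z + l * k.1 + r)) with hi
    have h1 : v k = e.op (T * k.2) (y + i) := by
      rw [v_apply]
      exact e.mild_add x hg (z + l * k.1) (T * k.2)
    have hc : Continuous fun r => e.op (-r) (g (z + l * k.1 + r)) :=
      Continuous.orthogonalGroup_op e continuous_neg (by fun_prop)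
    have h2 : (T * k.2 : ℝ) • ∫ ρ : I, e.op (-(T * k.2 * ρ))
        (γ (k.1, k.2 * ρ) - P (γ (k.1, k.2 * ρ))) = i - P i := by
      have h3 : ∀ ρ : I, e.op (-(T * k.2 * ρ)) (γ (k.1, k.2 * ρ) - P (γ (k.1, k.2 * ρ))) =
          (ContinuousLinearMap.id ℝ H - P)
            (e.op (-(T * k.2 * ρ)) (g (z + l * k.1 + (T * k.2 * ρ)))) := by
        intro ρ
        rw [γ_apply]
        have : z + l * k.1 + T * ((k.2 * ρ : I) : ℝ) = z + l * k.1 + T * k.2 * ρ := by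
          rw [Set.Icc.coe_mul]; ring
        simp only [this]
        change _ = e.op _ _ - P (e.op _ _)
        rw [hP, map_sub]
      simp only [h3]
      rw [smul_integral_unitInterval
        (fun r => (ContinuousLinearMap.id ℝ H - P) (e.op (-r) (g (z + l * k.1 + r)))),
        ContinuousLinearMap.intervalIntegral_comp_comm _ (hc.intervalIntegrable _ _)]
      rfl
    have h4 : w k = y - P y := rfl
    rw [h2, h1, h4, hP]
    simp only [map_add, map_sub]
    abel
  have hRv : C.compLeftContinuous ℝ (I × I) v = 0 := by
    ext k
    exact hC k
  -- The argument of `1 - R C` is `v` minus the free solution; as `C v = 0` and `R C` fixes free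
  -- solutions, the subtracted term is restored.
  rw [hp, hq, add_sub_assoc', add_sub_cancel]
  change (v - e.mapOp (scaledSnd T) w) -
    R (C.compLeftContinuous ℝ (I × I) (v - e.mapOp (scaledSnd T) w)) = v
  rw [map_sub (C.compLeftContinuous ℝ (I × I)), hRv, zero_sub, map_neg, hR w fun k => rfl]
  abel

end Window

end

section

open scoped unitInterval

/-! ### Superposition operators. -/

section Nemytskii

variable {K Y Z : Type*} [TopologicalSpace K] [TopologicalSpace Y] [TopologicalSpace Z] [Zero Z]

open Classical in
/-- The superposition operator `u ↦ F ∘ u`, with value `0` where `F ∘ u` is not continuous. -/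
noncomputable def nemytskii (F : Y → Z) (u : C(K, Y)) : C(K, Z) :=
  if h : Continuous fun k => F (u k) then ⟨_, h⟩ else 0

theorem nemytskii_apply {F : Y → Z} {s : Set Y} (hF : ContinuousOn F s) {u : C(K, Y)}
    (hu : ∀ k, u k ∈ s) (k : K) : nemytskii F u k = F (u k) := by
  have h : Continuous fun k => F (u k) := hF.comp_continuous u.continuous hu
  rw [nemytskii, dif_pos h]
  rfl

end Nemytskii

theorem norm_nemytskii_sub_le {K Y Z : Type*} [TopologicalSpace K] [CompactSpace K]
    [NormedAddCommGroup Y] [NormedAddCommGroup Z] {F : Y → Z} {s : Set Y}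
    (hF : ContinuousOn F s) {c : ℝ} (hc : 0 ≤ c)
    (hlip : ∀ u ∈ s, ∀ v ∈ s, ‖F u - F v‖ ≤ c * ‖u - v‖) {u v : C(K, Y)} (hu : ∀ k, u k ∈ s)
    (hv : ∀ k, v k ∈ s) : ‖nemytskii F u - nemytskii F v‖ ≤ c * ‖u - v‖ := by
  refine (ContinuousMap.norm_le _ (by positivity)).2 fun k => ?_
  rw [ContinuousMap.sub_apply, nemytskii_apply hF hu, nemytskii_apply hF hv]
  exact (hlip _ (hu k) _ (hv k)).trans
    (mul_le_mul_of_nonneg_left ((u - v).norm_coe_le_norm k) hc)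

/-- The Lipschitz bound gives continuity in the uniform norm, the chain rule gives holomorphy at
each point, and `ContinuousMap.differentiableOn_of_eval` combines them without differentiating the
superposition operator itself. -/
theorem differentiableOn_nemytskii {K Y Z : Type*} [TopologicalSpace K] [CompactSpace K]
    [NormedAddCommGroup Y] [NormedAddCommGroup Z] [NormedSpace ℂ Y] [NormedSpace ℂ Z]
    [CompleteSpace Z] {F : Y → Z} {s : Set Y} (hF : DifferentiableOn ℂ F s)
    {c : ℝ} (hc : 0 ≤ c) (hlip : ∀ u ∈ s, ∀ v ∈ s, ‖F u - F v‖ ≤ c * ‖u - v‖)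
    {f : ℂ → C(K, Y)} {U : Set ℂ} (hU : IsOpen U) (hf : DifferentiableOn ℂ f U)
    (hfs : ∀ l ∈ U, ∀ k, f l k ∈ s) : DifferentiableOn ℂ (fun l => nemytskii F (f l)) U := by
  refine ContinuousMap.differentiableOn_of_eval hU ?_ fun k => ?_
  · have h1 : LipschitzOnWith c.toNNReal (fun u : C(K, Y) => nemytskii F u)
        {u | ∀ k, u k ∈ s} := by
      refine LipschitzOnWith.of_dist_le_mul fun u hu v hv => ?_
      rw [dist_eq_norm, dist_eq_norm, Real.coe_toNNReal _ hc]
      exact norm_nemytskii_sub_le hF.continuousOn hc hlip hu hv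
    exact h1.continuousOn.comp hf.continuousOn hfs
  · have h2 : DifferentiableOn ℂ (fun l => f l k) U :=
      (ContinuousMap.evalCLM ℂ k : C(K, Y) →L[ℂ] Y).differentiable.comp_differentiableOn hf
    refine (hF.comp h2 fun l hl => hfs l hl k).congr fun l hl => ?_
    exact nemytskii_apply hF.continuousOn (hfs l hl) k

/-! ### Sources on a complex rectangle. -/

section Rectangle

open Complex

/-- Compose with the retraction that clamps the real and imaginary parts. A globally continuous map
is needed to form `window`; its values off the rectangle play no role. -/
theorem exists_continuousMap_eqOn_reProdIm {Y : Type*} [TopologicalSpace Y] {f : ℂ → Y}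
    {a b c d : ℝ} (hab : a ≤ b) (hcd : c ≤ d)
    (hf : ContinuousOn f (Set.Icc a b ×ℂ Set.Icc c d)) :
    ∃ f' : C(ℂ, Y), ∀ w ∈ Set.Icc a b ×ℂ Set.Icc c d, f' w = f w := by
  let π : ℂ → ℂ := fun w => (Set.projIcc a b hab w.re : ℝ) + (Set.projIcc c d hcd w.im : ℝ) * Complex.I
  have hπ : Continuous π := by
    have h1 : Continuous fun w : ℂ => ((Set.projIcc a b hab w.re : Set.Icc a b) : ℝ) :=
      continuous_subtype_val.comp (continuous_projIcc.comp continuous_re)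
    have h2 : Continuous fun w : ℂ => ((Set.projIcc c d hcd w.im : Set.Icc c d) : ℝ) :=
      continuous_subtype_val.comp (continuous_projIcc.comp continuous_im)
    exact (continuous_ofReal.comp h1).add ((continuous_ofReal.comp h2).mul continuous_const)
  have hmem : ∀ w, π w ∈ Set.Icc a b ×ℂ Set.Icc c d := by
    intro w
    rw [mem_reProdIm]
    simp [π]
  refine ⟨⟨fun w => f (π w), hf.comp_continuous hπ hmem⟩, fun w hw => ?_⟩
  change f (π w) = f w
  congr 1
  rw [mem_reProdIm] at hw
  simp only [π, Set.projIcc_of_mem hab hw.1, Set.projIcc_of_mem hcd hw.2]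
  exact re_add_im w

theorem window_mem_rectangle {z T S μ r : ℝ} (hT : 0 ≤ T) (hz : r ≤ z) (hz' : z + T + r ≤ S)
    (hμ : r ≤ μ) {l : ℂ} (hl : ‖l‖ < r) (k : I × I) :
    (z : ℂ) + l * ((k.1 : ℝ) : ℂ) + (T : ℂ) * ((k.2 : ℝ) : ℂ) ∈
      Set.Ioo 0 S ×ℂ Set.Ioo (-μ) μ := by
  obtain ⟨⟨s, hs0, hs1⟩, ⟨θ, hθ0, hθ1⟩⟩ := k
  have h1 := (abs_re_le_norm l).trans_lt hl
  have h2 := (abs_im_le_norm l).trans_lt hl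
  have key : ∀ y : ℝ, |y| < r → -r < y * s ∧ y * s < r := by
    intro y hy
    have : |y * s| < r := by
      rw [abs_mul, abs_of_nonneg hs0]
      exact (mul_le_of_le_one_right (abs_nonneg y) hs1).trans_lt hy
    exact abs_lt.1 this
  obtain ⟨h3, h4⟩ := key _ h1
  obtain ⟨h5, h6⟩ := key _ h2
  have h7 : 0 ≤ T * θ := mul_nonneg hT hθ0
  have h8 : T * θ ≤ T := mul_le_of_le_one_right hT hθ1
  rw [mem_reProdIm]
  simp only [add_re, add_im, mul_re, mul_im, ofReal_re, ofReal_im, mul_zero, sub_zero, zero_mul,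
    add_zero, zero_add]
  refine ⟨⟨?_, ?_⟩, ⟨?_, ?_⟩⟩ <;> linarith

theorem reProdIm_Ioo_subset_Icc (a b c d : ℝ) :
    Set.Ioo a b ×ℂ Set.Ioo c d ⊆ Set.Icc a b ×ℂ Set.Icc c d := fun _ hw =>
  ⟨Set.Ioo_subset_Icc_self hw.1, Set.Ioo_subset_Icc_self hw.2⟩

theorem differentiableOn_window {Y : Type*} [NormedAddCommGroup Y] [NormedSpace ℂ Y]
    [CompleteSpace Y] (f' : C(ℂ, Y)) {f : ℂ → Y} {z T S μ r : ℝ} (hT : 0 ≤ T) (hz : r ≤ z)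
    (hz' : z + T + r ≤ S) (hμ : r ≤ μ)
    (hf : DifferentiableOn ℂ f (Set.Ioo 0 S ×ℂ Set.Ioo (-μ) μ))
    (hff' : ∀ w ∈ Set.Icc 0 S ×ℂ Set.Icc (-μ) μ, f' w = f w) :
    DifferentiableOn ℂ (window f' z T) (Metric.ball 0 r) := by
  refine ContinuousMap.differentiableOn_of_eval Metric.isOpen_ball
    (window f' z T).continuous.continuousOn fun k => ?_
  have h1 : ∀ l ∈ Metric.ball (0 : ℂ) r, (z : ℂ) + l * ((k.1 : ℝ) : ℂ) +
      (T : ℂ) * ((k.2 : ℝ) : ℂ) ∈ Set.Ioo 0 S ×ℂ Set.Ioo (-μ) μ := fun l hl =>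
    window_mem_rectangle hT hz hz' hμ (mem_ball_zero_iff.1 hl) k
  have h2 : DifferentiableOn ℂ (fun l : ℂ => (z : ℂ) + l * ((k.1 : ℝ) : ℂ) +
      (T : ℂ) * ((k.2 : ℝ) : ℂ)) (Metric.ball 0 r) := by fun_prop
  refine (hf.comp h2 h1).congr fun l hl => ?_
  rw [window_apply]
  exact hff' _ (reProdIm_Ioo_subset_Icc _ _ _ _ (h1 l hl))

end Rectangle

namespace Complexified

variable {Y : Type*} [NormedAddCommGroup Y] [InnerProductSpace ℝ Y]
  {K : Type*} [TopologicalSpace K]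

theorem mapOfReal_add (u v : C(K, Y)) : mapOfReal (u + v) = mapOfReal u + mapOfReal v := by
  ext k
  exact ofReal_add _ _

theorem mapOfReal_smul (c : ℝ) (u : C(K, Y)) : mapOfReal (c • u) = (c : ℂ) • mapOfReal u := by
  ext k
  exact ofReal_real_smul _ _

theorem norm_mapOfReal_sub_le [CompactSpace K] (u v : C(K, Y)) : ‖mapOfReal u - mapOfReal v‖ ≤ ‖u - v‖ := by
  refine (ContinuousMap.norm_le _ (norm_nonneg _)).2 fun k => ?_
  have : (mapOfReal u - mapOfReal v) k = ofReal ((u - v) k) :=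
    (map_sub (ofRealCLM (Y := Y)) (u k) (v k)).symm
  rw [this, norm_ofReal]
  exact (u - v).norm_coe_le_norm k

end Complexified

/-! ### The contraction argument and analyticity of mild solutions. -/

open Metric in
/-- The fixed point theorem for `u = α + l (β₂ u + β₃ Γ(l, u)) + β₄ Γ(l, u)`, with `β₄` small and
`l` near `0`. -/
theorem exists_differentiableOn_fixedPoint_affine {E E' : Type*} [NormedAddCommGroup E]
    [NormedSpace ℂ E] [CompleteSpace E] [NormedAddCommGroup E'] [NormedSpace ℂ E']
    (α : E) (β₂ : E →L[ℂ] E) (β₃ β₄ : E' →L[ℂ] E) (Γ : ℂ → E → E') {u₀ : E} {r₀ ρ c : ℝ}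
    (hr₀ : 0 < r₀) (hρ : 0 < ρ) (hc : 0 < c) (hβ₄ : ∀ y, c * ‖β₄ y‖ ≤ 1 / 4 * ‖y‖)
    (hΓl : ∀ l ∈ ball (0 : ℂ) r₀, ∀ u ∈ closedBall u₀ ρ, ∀ w ∈ closedBall u₀ ρ,
      ‖Γ l u - Γ l w‖ ≤ c * ‖u - w‖)
    (hΓh : ∀ r ≤ r₀, ∀ g : ℂ → E, DifferentiableOn ℂ g (ball 0 r) →
      (∀ l ∈ ball (0 : ℂ) r, g l ∈ closedBall u₀ ρ) →
      DifferentiableOn ℂ (fun l => Γ l (g l)) (ball 0 r))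
    (hfix : α + β₄ (Γ 0 u₀) = u₀) :
    ∃ r : ℝ, 0 < r ∧ r ≤ r₀ ∧ ∃ f : ℂ → E, DifferentiableOn ℂ f (ball 0 r) ∧
      ∀ l ∈ ball (0 : ℂ) r, ∀ v ∈ closedBall u₀ ρ,
        α + l • (β₂ v + β₃ (Γ l v)) + β₄ (Γ l v) = v → f l = v := by
  set Φ : ℂ → E → E := fun l u => α + l • (β₂ u + β₃ (Γ l u)) + β₄ (Γ l u) with hΦ
  have hΦh : ∀ r ≤ r₀, ∀ g : ℂ → E, DifferentiableOn ℂ g (ball 0 r) →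
      (∀ l ∈ ball (0 : ℂ) r, g l ∈ closedBall u₀ ρ) →
      DifferentiableOn ℂ (fun l => Φ l (g l)) (ball 0 r) := by
    intro r hr g hgd hgm
    have dΓ := hΓh r hr g hgd hgm
    exact ((differentiableOn_const _).add (differentiableOn_id.smul
      ((β₂.differentiable.comp_differentiableOn hgd).add
        (β₃.differentiable.comp_differentiableOn dΓ)))).add
      (β₄.differentiable.comp_differentiableOn dΓ)
  have hu₀m : u₀ ∈ closedBall u₀ ρ := mem_closedBall_self hρ.le
  have hΦ₀ : ContinuousAt (fun l => Φ l u₀) 0 :=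
    ((hΦh r₀ le_rfl (fun _ => u₀) (differentiableOn_const u₀)
      (fun _ _ => hu₀m)).differentiableAt (ball_mem_nhds 0 hr₀)).continuousAt
  have hΦ00 : Φ 0 u₀ = u₀ := by
    simp only [hΦ, zero_smul, add_zero, hfix]
  -- Because `u₀` solves the equation at `l = 0`, continuity in `l` alone keeps `Φ l u₀` within `ρ /
  -- 2` of it.
  obtain ⟨r₂, hr₂, hΦr⟩ := Metric.continuousAt_iff.1 hΦ₀ (ρ / 2) (by positivity)
  set q := ‖β₂‖ + ‖β₃‖ * c with hq
  have hq0 : 0 ≤ q := by positivity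
  -- The contraction constant 1/2 is split evenly: 1/4 from the term with the factor `l`, by taking
  -- `r` small against `q`, and 1/4 from `β₄`.
  obtain ⟨r, hr, hrr₀, hrr₂, hrq⟩ : ∃ r : ℝ, 0 < r ∧ r ≤ r₀ ∧ r ≤ r₂ ∧ r * q ≤ 1 / 4 := by
    refine ⟨min r₀ (min r₂ (1 / (4 * (q + 1)))), by positivity, min_le_left _ _,
      (min_le_right _ _).trans (min_le_left _ _), ?_⟩
    calc _ ≤ 1 / (4 * (q + 1)) * (q + 1) :=
          mul_le_mul ((min_le_right _ _).trans (min_le_right _ _)) (by linarith) hq0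
            (by positivity)
      _ = 1 / 4 := by field_simp
  obtain ⟨f, hf, hfv⟩ := exists_differentiableOn_fixedPoint Φ u₀ (r := r) (ρ := ρ) (by
      intro l hl u hu w hw
      have hl' := mem_ball_zero_iff.1 hl
      have h1 := hΓl l (ball_subset_ball hrr₀ hl) u hu w hw
      have h2 : Φ l u - Φ l w = l • (β₂ (u - w) + β₃ (Γ l u - Γ l w)) +
          β₄ (Γ l u - Γ l w) := by
        simp only [hΦ, map_sub]
        module
      have h3 : ‖β₂ (u - w) + β₃ (Γ l u - Γ l w)‖ ≤ q * ‖u - w‖ := by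
        refine (norm_add_le _ _).trans ?_
        have e1 := β₂.le_opNorm (u - w)
        have e2 := β₃.le_opNorm (Γ l u - Γ l w)
        have e3 := mul_le_mul_of_nonneg_left h1 (norm_nonneg β₃)
        rw [hq, add_mul, mul_assoc]
        linarith
      have h4 : ‖β₄ (Γ l u - Γ l w)‖ ≤ 1 / 4 * ‖u - w‖ := by
        have := (hβ₄ (Γ l u - Γ l w)).trans
          (mul_le_mul_of_nonneg_left h1 (by norm_num : (0 : ℝ) ≤ 1 / 4))
        rw [mul_left_comm] at this
        exact le_of_mul_le_mul_left this hc
      have h5 : ‖l • (β₂ (u - w) + β₃ (Γ l u - Γ l w))‖ ≤ 1 / 4 * ‖u - w‖ := by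
        rw [norm_smul]
        calc _ ≤ r * (q * ‖u - w‖) := by gcongr
          _ = (r * q) * ‖u - w‖ := by ring
          _ ≤ _ := by gcongr
      rw [h2]
      refine (norm_add_le _ _).trans ?_
      linarith) (by
      intro l hl
      have := hΦr (x := l) (by
        rw [dist_zero_right]; exact (mem_ball_zero_iff.1 hl).trans_le hrr₂)
      rw [hΦ00, dist_eq_norm] at this
      exact this.le) (hΦh r hrr₀)
  exact ⟨r, hr, hrr₀, f, hf, hfv⟩

open Metric Complexified in
/-- A mild solution of `V' = A V + F(V + H₁) + H₂` with `C V = 0`, where `C` observes `e^{tA}` and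
`F` is holomorphic and regularizing, is analytic. The low frequencies of the translates of `V` solve
an ordinary differential equation with values in the continuous functions on the observation window,
and the high frequencies are recovered from them by a contraction; since the low frequencies are
kept on the whole window, no commutator estimate on `C` is used. -/
theorem OrthogonalGroup.analyticAt_mild {H G : Type*} [NormedAddCommGroup H]
    [InnerProductSpace ℝ H] [CompleteSpace H] [NormedAddCommGroup G] [InnerProductSpace ℝ G]
    [CompleteSpace G] (e : OrthogonalGroup H) (ι : G →L[ℝ] H)
    (hcut : ∀ η : ℝ, 0 < η → ∃ P B : H →L[ℝ] H, (∀ t x, P (e.op t x) = e.op t (P x)) ∧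
      (∀ t, HasDerivAt (fun t => (e.op t).comp P) (B.comp (e.op t)) t) ∧
      ∀ y, ‖ι y - P (ι y)‖ ≤ η * ‖y‖)
    (C : H →L[ℝ] H) {T K : ℝ} (hT : 0 ≤ T) (hK : 0 < K)
    (hobs : ∀ W : H, ‖W‖ ^ 2 ≤ K ^ 2 * ∫ t in (0 : ℝ)..T, ‖C (e.op t W)‖ ^ 2)
    {M δ c : ℝ} (hδ : 0 < δ) (hc : 0 < c) {F : H → G} {F' : Complexified H → Complexified G}
    (hFF' : ∀ u, ‖u‖ ≤ M → F' (ofReal u) = ofReal (F u))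
    (hF'd : DifferentiableOn ℂ F' (interior (cylinder H M δ)))
    (hF'l : ∀ u ∈ cylinder H M δ, ∀ v ∈ cylinder H M δ, ‖F' u - F' v‖ ≤ c * ‖u - v‖)
    {S μ : ℝ} (hμ : 0 < μ) {H₁ : ℝ → H} (hH₁ : ContinuousOn H₁ (Set.Icc 0 S))
    {H₁' : ℂ → Complexified H} (hH₁' : IsHolomorphicExtension H₁ H₁' S μ)
    {H₂ : ℝ → G} {H₂' : ℂ → Complexified G} (hH₂' : IsHolomorphicExtension H₂ H₂' S μ)
    (x : H) {g : ℝ → G} (hg : Continuous g)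
    (hgV : ∀ t ∈ Set.Icc 0 S, g t = F (e.mild x (fun t => ι (g t)) t + H₁ t) + H₂ t)
    (hball : ∀ t ∈ Set.Icc 0 S, ‖e.mild x (fun t => ι (g t)) t + H₁ t‖ < M)
    (hCV : ∀ t ∈ Set.Icc 0 S, C (e.mild x (fun t => ι (g t)) t) = 0)
    {z : ℝ} (hz : 0 < z) (hzS : z + T < S) (θ : I) :
    AnalyticAt ℝ (e.mild x fun t => ι (g t)) (z + T * θ) := by
  have hιg : Continuous fun t => ι (g t) := ι.continuous.comp hg
  have hVc := e.continuous_mild x hιg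
  set V := e.mild x (fun t => ι (g t)) with hV
  have hS : 0 ≤ S := by linarith
  -- the sources
  obtain ⟨f₁, hf₁⟩ := exists_continuousMap_eqOn_reProdIm hS (by linarith) hH₁'.1
  obtain ⟨f₂, hf₂⟩ := exists_continuousMap_eqOn_reProdIm hS (by linarith) hH₂'.1
  set h₁ := window f₁ z T with hh₁
  set h₂ := window f₂ z T with hh₂
  obtain ⟨r₀, hr₀, hr₀z, hr₀S, hr₀μ⟩ : ∃ r₀ : ℝ, 0 < r₀ ∧ r₀ ≤ z ∧ z + T + r₀ ≤ S ∧ r₀ ≤ μ :=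
    ⟨min z (min (S - (z + T)) μ), by
      refine lt_min hz (lt_min (by linarith) hμ), min_le_left _ _, by
      linarith [(min_le_right z (min (S - (z + T)) μ)).trans (min_le_left _ _)],
      (min_le_right _ _).trans (min_le_right _ _)⟩
  have real_mem : ∀ l : ℝ, |l| < r₀ → ∀ k : I × I, z + l * k.1 + T * k.2 ∈ Set.Icc 0 S := by
    intro l hl k
    have h := (window_mem_rectangle hT hr₀z hr₀S hr₀μ (l := (l : ℂ)) (by simpa using hl) k).1
    refine Set.Ioo_subset_Icc_self ?_
    simpa using h
  have real_eq : ∀ (l : ℝ) (k : I × I), (z : ℂ) + (l : ℂ) * ((k.1 : ℝ) : ℂ) +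
      (T : ℂ) * ((k.2 : ℝ) : ℂ) = ((z + l * k.1 + T * k.2 : ℝ) : ℂ) := by
    intro l k; push_cast; ring
  have real_mem' : ∀ t ∈ Set.Icc 0 S, (t : ℂ) ∈ Set.Icc 0 S ×ℂ Set.Icc (-μ) μ := by
    intro t ht
    rw [Complex.mem_reProdIm]
    simp only [Complex.ofReal_re, Complex.ofReal_im]
    exact ⟨ht, by linarith, by linarith⟩
  have h₁_real : ∀ l : ℝ, |l| < r₀ → ∀ k : I × I,
      h₁ (l : ℂ) k = ofReal (H₁ (z + l * k.1 + T * k.2)) := by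
    intro l hl k
    have ht := real_mem l hl k
    rw [hh₁, window_apply, real_eq, hf₁ _ (real_mem' _ ht), hH₁'.2.2 _ ht]
  have h₂_real : ∀ l : ℝ, |l| < r₀ → ∀ k : I × I,
      h₂ (l : ℂ) k = ofReal (H₂ (z + l * k.1 + T * k.2)) := by
    intro l hl k
    have ht := real_mem l hl k
    rw [hh₂, window_apply, real_eq, hf₂ _ (real_mem' _ ht), hH₂'.2.2 _ ht]
  -- the domain of the nonlinearity
  set Ω : Set (Complexified H) := {u | ‖u.re‖ < M ∧ ‖u.im‖ < δ} with hΩ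
  have hΩo : IsOpen Ω := (isOpen_lt continuous_re.norm continuous_const).inter
    (isOpen_lt continuous_im.norm continuous_const)
  have hΩc : Ω ⊆ cylinder H M δ := fun u hu => ⟨hu.1.le, hu.2.le⟩
  have hFd : DifferentiableOn ℂ F' Ω := hF'd.mono (interior_maximal hΩc hΩo)
  have hFl : ∀ u ∈ Ω, ∀ v ∈ Ω, ‖F' u - F' v‖ ≤ c * ‖u - v‖ := fun u hu v hv =>
    hF'l u (hΩc hu) v (hΩc hv)
  -- Compactness of the time interval turns the strict bound by `M` into a uniform margin.
  obtain ⟨κ, hκ, hκM⟩ : ∃ κ : ℝ, 0 < κ ∧ ∀ t ∈ Set.Icc 0 S, ‖V t + H₁ t‖ ≤ M - κ := by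
    obtain ⟨t₀, ht₀, hmax⟩ := isCompact_Icc.exists_isMaxOn (Set.nonempty_Icc.2 hS)
      ((hVc.continuousOn.add hH₁).norm)
    refine ⟨M - ‖V t₀ + H₁ t₀‖, by linarith [hball t₀ ht₀], fun t ht => ?_⟩
    have := hmax ht
    simp only [Set.mem_ofPred_eq, Pi.add_apply] at this
    linarith
  -- Two perturbations of size at most `ρ`, one of the solution and one of the source, must leave
  -- the argument of `F'` strictly inside the cylinder.
  obtain ⟨ρ, hρ, hρκ, hρδ⟩ : ∃ ρ : ℝ, 0 < ρ ∧ 4 * ρ ≤ κ ∧ 4 * ρ ≤ δ :=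
    ⟨min κ δ / 4, by positivity, by linarith [min_le_left κ δ], by linarith [min_le_right κ δ]⟩
  -- the operators
  obtain ⟨R, hR⟩ := e.exists_reconstruction C hK hobs
  set B₁ : C(I × I, H) →L[ℝ] C(I × I, H) :=
    ContinuousLinearMap.id ℝ C(I × I, H) - R.comp (C.compLeftContinuous ℝ (I × I)) with hB₁
  set D := B₁.comp (e.duhamel T) with hD
  -- The cut-off is chosen after `D`, which does not depend on it. The constant 8 leaves 1/4 after
  -- the factor 2 of complexification, and `‖D‖ + 1` avoids division by zero.
  obtain ⟨P, B, hP, hB, hPι⟩ := hcut (1 / (8 * (‖D‖ + 1) * c)) (by positivity)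
  set b₂ := (B₁.comp primFst).comp (B.compLeftContinuous ℝ (I × I)) with hb₂
  set b₃ := (B₁.comp primFst).comp ((P.comp ι).compLeftContinuous ℝ (I × I)) with hb₃
  set b₄ := D.comp (((ContinuousLinearMap.id ℝ H - P).comp ι).compLeftContinuous ℝ (I × I))
    with hb₄
  have hb₄n : 2 * ‖b₄‖ * c ≤ 1 / 4 := by
    have h1 : ‖((ContinuousLinearMap.id ℝ H - P).comp ι).compLeftContinuous ℝ (I × I)‖ ≤
        1 / (8 * (‖D‖ + 1) * c) := by
      refine ContinuousLinearMap.opNorm_le_bound _ (by positivity) fun u => ?_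
      refine (ContinuousMap.norm_le _ (by positivity)).2 fun k => ?_
      exact (hPι (u k)).trans (mul_le_mul_of_nonneg_left (u.norm_coe_le_norm k) (by positivity))
    have h2 : ‖b₄‖ ≤ (‖D‖ + 1) * (1 / (8 * (‖D‖ + 1) * c)) :=
      (ContinuousLinearMap.opNorm_comp_le _ _).trans
        (mul_le_mul (by linarith) h1 (norm_nonneg _) (by positivity))
    have h3 : (‖D‖ + 1) * (1 / (8 * (‖D‖ + 1) * c)) = 1 / (8 * c) := by field_simp
    rw [h3] at h2
    calc 2 * ‖b₄‖ * c ≤ 2 * (1 / (8 * c)) * c := by gcongr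
      _ = 1 / 4 := by field_simp; norm_num
  set v : ℝ → C(I × I, H) := fun l => window (realExt V hVc) z T (l : ℂ) with hv
  have v_apply : ∀ l k, v l k = V (z + l * k.1 + T * k.2) := fun l k =>
    window_realExt _ _ _ _ _ _
  set a := P.compLeftContinuous ℝ (I × I) (v 0) with ha
  set Γ : ℂ → C(I × I, Complexified H) → C(I × I, Complexified G) :=
    fun l u => nemytskii F' (u + h₁ l) + h₂ l with hΓ
  -- the translates of `V` are fixed points
  have hfix : ∀ l : ℝ, |l| < r₀ → mapOfReal (B₁ a) + (l : ℂ) • (mapCLM b₂ (mapOfReal (v l)) +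
      mapCLM b₃ (Γ l (mapOfReal (v l)))) + mapCLM b₄ (Γ l (mapOfReal (v l))) =
        mapOfReal (v l) := by
    intro l hl
    have h1 : Γ (l : ℂ) (mapOfReal (v l)) =
        mapOfReal (window (realExt g hg) z T (l : ℂ)) := by
      have h2 : ∀ k, (mapOfReal (v l) + h₁ (l : ℂ)) k =
          ofReal (V (z + l * k.1 + T * k.2) + H₁ (z + l * k.1 + T * k.2)) := by
        intro k
        rw [ContinuousMap.add_apply, h₁_real l hl, ofReal_add, ← v_apply]
        rfl
      have h3 : ∀ k, (mapOfReal (v l) + h₁ (l : ℂ)) k ∈ Ω := by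
        intro k
        rw [h2]
        refine ⟨hball _ (real_mem l hl k), ?_⟩
        change ‖(0 : H)‖ < δ
        rwa [norm_zero]
      ext k
      change (nemytskii F' (mapOfReal (v l) + h₁ (l : ℂ)) + h₂ (l : ℂ)) k =
        ofReal (window (realExt g hg) z T (l : ℂ) k)
      rw [ContinuousMap.add_apply, nemytskii_apply hFd.continuousOn h3, h2, h₂_real l hl,
        hFF' _ (hball _ (real_mem l hl k)).le, ← ofReal_add, ← hgV _ (real_mem l hl k),
        window_realExt]
    have h4 := e.window_mild_eq x hιg hP hB C R hR z l (v l)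
      (window (realExt _ hιg) z T (l : ℂ)) a rfl rfl rfl (fun k => by
        rw [v_apply]; exact hCV _ (real_mem l hl k))
    rw [h1, mapCLM_mapOfReal, mapCLM_mapOfReal, mapCLM_mapOfReal, ← mapOfReal_add,
      ← mapOfReal_smul, ← mapOfReal_add, ← mapOfReal_add]
    congr 1
    refine Eq.trans ?_ h4
    rw [map_add B₁, map_add B₁, map_smul B₁, map_add primFst, map_add B₁]
    rfl
  -- choice of the radius
  set u₀ := mapOfReal (v 0) with hu₀
  obtain ⟨r₁, hr₁, hh₁r⟩ := Metric.continuous_iff.1 h₁.continuous 0 ρ hρ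
  have hmem : ∀ l : ℂ, ‖l‖ < r₁ → ∀ u ∈ closedBall u₀ ρ, ∀ k, (u + h₁ l) k ∈ Ω := by
    intro l hl u hu k
    have h1 : ‖(u - u₀) k‖ ≤ ρ := by
      rw [mem_closedBall, dist_eq_norm] at hu
      exact ((u - u₀).norm_coe_le_norm k).trans hu
    have h2 : ‖(h₁ l - h₁ 0) k‖ ≤ ρ := by
      have := (hh₁r l (by rwa [dist_zero_right])).le
      rw [dist_eq_norm] at this
      exact ((h₁ l - h₁ 0).norm_coe_le_norm k).trans this
    have h3 : (u + h₁ l) k = (u - u₀) k + (h₁ l - h₁ 0) k +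
        ofReal (V (z + 0 * k.1 + T * k.2) + H₁ (z + 0 * k.1 + T * k.2)) := by
      have h4 := h₁_real 0 (by simpa using hr₀) k
      rw [Complex.ofReal_zero] at h4
      rw [ofReal_add, ← h4, ← v_apply]
      change u k + h₁ l k = (u k - u₀ k) + (h₁ l k - h₁ 0 k) + (u₀ k + h₁ 0 k)
      abel
    have h5 := hκM _ (real_mem 0 (by simpa using hr₀) k)
    rw [h3]
    constructor
    · rw [re_add, re_add]
      have e1 := (norm_re_le ((u - u₀) k)).trans h1
      have e2 := (norm_re_le ((h₁ l - h₁ 0) k)).trans h2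
      refine lt_of_le_of_lt (norm_add₃_le) ?_
      change _ + _ + ‖V (z + 0 * k.1 + T * k.2) + H₁ (z + 0 * k.1 + T * k.2)‖ < M
      linarith
    · rw [im_add, im_add]
      have e1 := (norm_im_le ((u - u₀) k)).trans h1
      have e2 := (norm_im_le ((h₁ l - h₁ 0) k)).trans h2
      refine lt_of_le_of_lt (norm_add₃_le) ?_
      change _ + _ + ‖(0 : H)‖ < δ
      rw [norm_zero]
      linarith
  have hr₀₁ : 0 < min r₀ r₁ := lt_min hr₀ hr₁
  have hmem' : ∀ l ∈ ball (0 : ℂ) (min r₀ r₁), ∀ u ∈ closedBall u₀ ρ, ∀ k,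
      (u + h₁ l) k ∈ Ω := fun l hl =>
    hmem l ((mem_ball_zero_iff.1 hl).trans_le (min_le_right _ _))
  obtain ⟨r, hr, hrr, f, hf, hfv⟩ := exists_differentiableOn_fixedPoint_affine
    (mapOfReal (B₁ a)) (mapCLM b₂) (mapCLM b₃) (mapCLM b₄) Γ hr₀₁ hρ hc (by
      intro y
      have h1 := mul_le_mul_of_nonneg_left (norm_mapCLM_le b₄ y) hc.le
      have h2 := mul_le_mul_of_nonneg_right hb₄n (norm_nonneg y)
      linarith) (by
      intro l hl u hu w hw
      have := norm_nemytskii_sub_le hFd.continuousOn hc.le hFl (hmem' l hl u hu)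
        (hmem' l hl w hw)
      rw [add_sub_add_right_eq_sub] at this
      simpa only [hΓ, add_sub_add_right_eq_sub] using this) (by
      intro r hr g hgd hgm
      have hrr₀ := hr.trans (min_le_left r₀ r₁)
      have d₁ : DifferentiableOn ℂ h₁ (ball 0 r) := differentiableOn_window f₁ hT
        (hrr₀.trans hr₀z) (by linarith) (hrr₀.trans hr₀μ) hH₁'.2.1 hf₁
      have d₂ : DifferentiableOn ℂ h₂ (ball 0 r) := differentiableOn_window f₂ hT
        (hrr₀.trans hr₀z) (by linarith) (hrr₀.trans hr₀μ) hH₂'.2.1 hf₂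
      exact (differentiableOn_nemytskii hFd hc.le hFl isOpen_ball (hgd.add d₁)
        fun l hl => hmem' l (ball_subset_ball hr hl) _ (hgm l hl)).add d₂) (by
      have := hfix 0 (by simpa using hr₀)
      simpa only [Complex.ofReal_zero, zero_smul, add_zero] using this)
  have hrr₀ : r ≤ r₀ := hrr.trans (min_le_left _ _)
  -- conclusion
  have hvc : Continuous v := (window (realExt V hVc) z T).continuous.comp Complex.continuous_ofReal
  obtain ⟨r₃, hr₃, hvr⟩ := Metric.continuous_iff.1 hvc 0 ρ hρ
  -- For small real `l` the translate stays in the ball by continuity, so uniqueness identifies it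
  -- with `f l`; the edge `s = 1` carries the full shift `l`.
  have hVf : ∀ l : ℝ, |l| < min r r₃ → V (z + T * θ + l) = (f (l : ℂ) (1, θ)).re := by
    intro l hl
    have hlr : |l| < r := hl.trans_le (min_le_left _ _)
    have h1 : mapOfReal (v l) ∈ closedBall u₀ ρ := by
      rw [mem_closedBall, dist_eq_norm]
      refine (norm_mapOfReal_sub_le _ _).trans ?_
      have := hvr l (by
        rw [dist_zero_right, Real.norm_eq_abs]; exact hl.trans_le (min_le_right _ _))
      rw [dist_eq_norm] at this
      exact this.le
    rw [hfv (l : ℂ) (by simpa using hlr) _ h1 (hfix l (hlr.trans_le hrr₀))]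
    change _ = v l (1, θ)
    rw [v_apply]
    congr 1
    simp only [Set.Icc.coe_one]
    ring
  have hf0 : AnalyticAt ℂ (fun l => f l (1, θ)) 0 := by
    have h1 : DifferentiableOn ℂ (fun l => f l (1, θ)) (ball 0 r) :=
      (ContinuousMap.evalCLM ℂ (1, θ) : C(I × I, Complexified H) →L[ℂ] _).differentiable
        |>.comp_differentiableOn hf
    exact h1.analyticAt (ball_mem_nhds 0 hr)
  have hf1 : AnalyticAt ℝ (fun t : ℝ => (f ((t - (z + T * θ) : ℝ) : ℂ) (1, θ)).re)
      (z + T * θ) := by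
    have h2 : AnalyticAt ℝ (fun t : ℝ => ((t - (z + T * θ) : ℝ) : ℂ)) (z + T * θ) :=
      (Complex.ofRealCLM.analyticAt _).comp (analyticAt_id.sub analyticAt_const)
    have h3 : AnalyticAt ℝ (fun l : ℂ => f l (1, θ)) ((z + T * θ - (z + T * θ) : ℝ) : ℂ) := by
      rw [sub_self, Complex.ofReal_zero]
      exact hf0.restrictScalars
    have h4 : AnalyticAt ℝ (fun t : ℝ => f ((t - (z + T * θ) : ℝ) : ℂ) (1, θ)) (z + T * θ) :=
      AnalyticAt.comp (f := fun t : ℝ => ((t - (z + T * θ) : ℝ) : ℂ)) h3 h2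
    exact (reCLM.analyticAt _).comp h4
  refine hf1.congr ?_
  filter_upwards [Metric.ball_mem_nhds (z + T * θ) (lt_min hr hr₃)] with t ht
  rw [mem_ball, Real.dist_eq] at ht
  rw [← hVf _ ht, add_sub_cancel]

end

/-! ### Application to the scale of `A`. -/

namespace SkewAdjointOp

variable {X : Type*} [NormedAddCommGroup X] [InnerProductSpace ℝ X] [CompleteSpace X]
  (A : SkewAdjointOp X)

theorem val_group_op {σ : ℝ} (hσ : 0 ≤ σ) (t : ℝ) (x : A.Scale σ) :
    ((A.group hσ).op t x).val = A.exp t x.val := by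
  change (A.expCLM hσ t x).val = _
  rw [expCLM_apply]
  rfl

/-- A mild solution satisfies the Duhamel formula in `X^σ`. -/
theorem eq_mild_of_val_eq {σ : ℝ} (hσ : 0 ≤ σ) {g : ℝ → A.Scale σ} (hg : Continuous g)
    {u x : A.Scale σ} {t : ℝ}
    (h : u.val = A.exp t x.val + ∫ r in (0 : ℝ)..t, A.exp (t - r) (g r).val) :
    u = (A.group hσ).mild x g t := by
  have : CompleteSpace (A.Scale σ) := A.completeSpace_scale hσ
  have hc : Continuous fun r => (A.group hσ).op (-r) (g r) :=
    Continuous.orthogonalGroup_op _ continuous_neg hg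
  apply Scale.val_injective
  rw [h, OrthogonalGroup.mild, map_add, map_add, val_group_op]
  congr 1
  have h1 := ((A.valCLM hσ).comp ((A.group hσ).op t)).intervalIntegral_comp_comm
    (hc.intervalIntegrable (μ := MeasureTheory.volume) 0 t)
  refine Eq.trans ?_ h1
  refine intervalIntegral.integral_congr fun r _ => ?_
  change _ = ((A.group hσ).op t ((A.group hσ).op (-r) (g r))).val
  rw [OrthogonalGroup.op_op, val_group_op, sub_eq_add_neg]

end SkewAdjointOp

theorem mainTheorem4 {X : Type*} [NormedAddCommGroup X] [InnerProductSpace ℝ X] [CompleteSpace X]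
    [TopologicalSpace.SeparableSpace X]
    (A : SkewAdjointOp X)
    {σ ε : ℝ} (hσ : 0 ≤ σ) (hε : 0 < ε)
    {R₀ T Tstar : ℝ} (hR₀ : 0 < R₀) (hT : 0 < T) (hTstar : T < Tstar)
    (C : A.Scale σ →L[ℝ] A.Scale σ)
    (hC : A.IsObservation hε C T)
    (hcomm : A.CommutatorBounded hσ ε C)
    (F : A.Scale σ → A.Scale (σ + ε))
    (hF : A.IsHolomorphicNonlinearity F (4 * R₀))
    (H₁ : ℝ → A.Scale σ) (hH₁ : ContinuousOn H₁ (Set.Icc 0 Tstar))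
    (hH₁R₀ : ∀ t ∈ Set.Icc 0 Tstar, ‖H₁ t‖ ≤ R₀)
    (H₂ : ℝ → A.Scale (σ + ε)) (hH₂ : ContinuousOn H₂ (Set.Icc 0 Tstar))
    {μ : ℝ} (hμ : 0 < μ)
    (H₁' : ℂ → Complexified (A.Scale σ)) (hH₁' : IsHolomorphicExtension H₁ H₁' Tstar μ)
    (hH₁'R₀ : ∀ z ∈ Set.Icc 0 Tstar ×ℂ Set.Icc (-μ) μ, ‖(H₁' z).re‖ ≤ R₀)
    (H₂' : ℂ → Complexified (A.Scale (σ + ε))) (hH₂' : IsHolomorphicExtension H₂ H₂' Tstar μ)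
    (U : ℝ → A.Scale σ)
    (hU : A.IsMildSolution F H₁ H₂ Tstar U)
    (hUball : ∀ t ∈ Set.Icc 0 Tstar, ‖U t + H₁ t‖ < 4 * R₀)
    (hCU : ∀ t ∈ Set.Icc 0 Tstar, C (U t) = 0) :
    AnalyticOnNhd ℝ U (Set.Ioo 0 Tstar) := by
  have hσε : σ < σ + ε := by linarith
  have : CompleteSpace (A.Scale σ) := A.completeSpace_scale hσ
  have : CompleteSpace (A.Scale (σ + ε)) := A.completeSpace_scale (by linarith)
  have hS : 0 ≤ Tstar := by linarith
  obtain ⟨⟨K, hK, hobs⟩, -⟩ := hC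
  obtain ⟨⟨c₀, hc₀, -, hFlip⟩, δ, hδ, F', hFF', hF'd, c, hc, -, hF'l⟩ := hF
  set ι := A.inclCLM hσε.le with hι
  have hG : ContinuousOn (fun t => F (U t + H₁ t) + H₂ t) (Set.Icc 0 Tstar) := by
    have hFc : ContinuousOn F {u | ‖u‖ ≤ 4 * R₀} := by
      have : LipschitzOnWith c₀.toNNReal F {u | ‖u‖ ≤ 4 * R₀} := by
        refine LipschitzOnWith.of_dist_le_mul fun u hu v hv => ?_
        rw [dist_eq_norm, dist_eq_norm, Real.coe_toNNReal _ hc₀.le]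
        exact hFlip u v hu hv
      exact this.continuousOn
    exact (hFc.comp (hU.1.add hH₁) fun t ht => (hUball t ht).le).add hH₂
  -- The forcing is extended by its endpoint values, so that it is continuous on the whole line; the
  -- resulting mild solution agrees with `U` on `[0, Tstar]`.
  set g : ℝ → A.Scale (σ + ε) := Set.IccExtend hS
    (Set.domRestrict (Set.Icc 0 Tstar) fun t => F (U t + H₁ t) + H₂ t) with hg
  have hgc : Continuous g := (continuousOn_iff_continuous_domRestrict.1 hG).Icc_extend'
  have hgeq : ∀ t ∈ Set.Icc 0 Tstar, g t = F (U t + H₁ t) + H₂ t := fun t ht => by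
    rw [hg, Set.IccExtend_of_mem _ _ ht]
    rfl
  have hUV : ∀ t ∈ Set.Icc 0 Tstar, U t = (A.group hσ).mild (U 0) (fun t => ι (g t)) t := by
    intro t ht
    refine A.eq_mild_of_val_eq hσ (ι.continuous.comp hgc) ?_
    rw [hU.2 t ht]
    congr 1
    refine intervalIntegral.integral_congr fun r hr => ?_
    rw [Set.uIcc_of_le ht.1] at hr
    rw [hι, Function.comp_apply, A.val_inclCLM, hgeq r ⟨hr.1, hr.2.trans ht.2⟩]
  intro t₀ ht₀
  have hθ : t₀ / Tstar ∈ unitInterval :=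
    ⟨div_nonneg ht₀.1.le hS, div_le_one_of_le₀ ht₀.2.le hS⟩
  have hS' : 0 < Tstar := by linarith
  have hr1 : 0 < t₀ / Tstar := div_pos ht₀.1 hS'
  have hr2 : t₀ / Tstar < 1 := (div_lt_one hS').2 ht₀.2
  -- Every interior time lies in an admissible window: with `θ = t₀ / Tstar` and `z = θ (Tstar -
  -- T)`, one has `z + T θ = t₀`, while `0 < θ < 1` gives `0 < z` and `z + T < Tstar`.
  have ht₀' : t₀ = t₀ / Tstar * (Tstar - T) + T * (t₀ / Tstar) := by field_simp; ring
  have main := (A.group hσ).analyticAt_mild ι (by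
      intro η hη
      obtain ⟨n, hn⟩ := A.exists_norm_highFreq_incl_le hσ hσε hη
      exact ⟨A.lowFreq hσ n, A.lowFreqOp hσ n, A.lowFreq_comm hσ n,
        A.hasDerivAt_exp_lowFreq hσ n, hn⟩) C hT.le hK (by
      intro W
      have h1 : ∀ t, (A.group hσ).op t W = A.expScale t W := fun t => A.expCLM_apply hσ t W
      simp only [h1]
      exact hobs W) (by linarith : 0 < 2 * δ) hc hFF' hF'd hF'l hμ hH₁ hH₁' hH₂' (U 0) hgc
    (fun t ht => by rw [← hUV t ht, hgeq t ht]) (fun t ht => by rw [← hUV t ht]; exact hUball t ht)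
    (fun t ht => by rw [← hUV t ht]; exact hCU t ht)
    (z := t₀ / Tstar * (Tstar - T)) (mul_pos hr1 (by linarith))
    (by nlinarith) ⟨t₀ / Tstar, hθ⟩
  change AnalyticAt ℝ _ (t₀ / Tstar * (Tstar - T) + T * (t₀ / Tstar)) at main
  rw [← ht₀'] at main
  refine main.congr ?_
  filter_upwards [isOpen_Ioo.mem_nhds ht₀] with t ht
  exact (hUV t (Set.Ioo_subset_Icc_self ht)).symm
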